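/- Let $1<p<\infty$ and let $(T_n)_n$ be a sequence of operators $T_n:L_p([0,1])\to L_p([0,1])$ (real functions, Lebesgue measure, a.e. order) such that each $T_n$ is - sublinear: $T_n(f+g)\le T_n(f)+T_n(g)$ and $T_n(\alpha f)=\alpha T_n(f)$ for all $f,g\in L_p([0,1])$ and $\alpha\ge 0$; - monotone: $f\le g$ implies $T_n(f)\le T_n(g)$; - strongly translatable: $T_n(f+\alpha\cdot 1)=T_n(f)+\alpha T_n(1)$ for all $f\in L_p([0,1])$ and $\alpha\in\mathbb{R}$. Suppose that the sequence is uniformly bounded: there is $R$ with $\|T_n f\|_p\le R\|f\|_p$ for all $n$ and all $f$. Write $e_0(t)=1$, $e_1(t)=t$. Let $T_n((e_1-x)^2)(x)$ denote the function of $x\in[0,1]$ obtained by applying $T_n$ to $t\mapsto (t-\xi)^2$ for each fixed $\xi\in[0,1]$ and then putting $\xi=x$; here the values are taken in a version $G(\xi,y)$ of $T_n((e_1-\xi)^2)(y)$ that is, for almost every $y$, continuous in $\xi\in[0,1]$ (such a version exists, and the resulting function $x\mapsto G(x,x)$ is uniquely determined almost everywhere). Put $$\mu_n=\|T_n((e_1-x)^2)(x)\|_\infty,$$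 $$s_{n,p}=\Big(\max\big\{\|T_n(e_0)-e_0\|_p,\ \big\|[T_n((e_1-x)^2)(x)]^{1/2}\big\|_p,\ \mu_n\big\}\Big)^{1/2}\in[0,\infty].$$ For $f\in L_p([0,1])$ let $$\omega_{2,p}(f;\delta)=\sup_{|h|\le\delta}\|f(\cdot+2h)-2f(\cdot+h)+f(\cdot)\|_p$$ be the second order modulus of smoothness, where the norm is taken over those $x\in[0,1]$ for which $x+2h\in[0,1]$. If $\lim_{n\to\infty}s_{n,p}=0$, then there is a constant $M_p>0$, independent of $f$ and $n$, such that for all $n$ and all $f\in L_p([0,1])$ $$\|T_n f-f\|_p\le M_p\left[s_{n,p}^2\,\|f\|_p+\omega_{2,p}(f;s_{n,p})\right],$$ where the right-hand side is read in $[0,\infty]$ with $\infty\cdot 0=0$. -/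

import Mathlib

open MeasureTheory Filter Set Topology
open scoped ENNReal

noncomputable section

namespace SublinearApprox

/-- Lebesgue measure on the interval `[0, 1]`. -/
abbrev muI : Measure ℝ := volume.restrict (Icc (0 : ℝ) 1)

/-- The space `L_p([0, 1])` of real functions, with its a.e. order. -/
abbrev LpI (p : ℝ≥0∞) : Type := Lp ℝ p muI

/-- The constant function `e_0 = 1` in `L_p([0, 1])`. -/
def e0 (p : ℝ≥0∞) : LpI p := Lp.const p muI (1 : ℝ)

theorem memLp_sq (p : ℝ≥0∞) (ξ : ℝ) : MemLp (fun t : ℝ => (t - ξ) ^ 2) p muI := by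
  have h : MemLp (fun t : ℝ => (t - ξ) ^ 2) ∞ muI := by
    refine memLp_top_of_bound (by fun_prop) ((1 + |ξ|) ^ 2) ?_
    filter_upwards [ae_restrict_mem measurableSet_Icc] with t ht
    have h1 : |t - ξ| ≤ 1 + |ξ| :=
      (abs_sub t ξ).trans (by rw [abs_of_nonneg ht.1]; linarith [ht.2])
    rw [Real.norm_eq_abs, abs_pow]
    exact pow_le_pow_left₀ (abs_nonneg _) h1 2
  exact h.mono_exponent le_top

/-- The function `(e_1 - ξ)^2`, that is `t ↦ (t - ξ)^2`, in `L_p([0, 1])`. -/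
def sqShift (p : ℝ≥0∞) (ξ : ℝ) : LpI p := (memLp_sq p ξ).toLp

/-- Monotone, sublinear and strongly translatable operators of `L_p([0, 1])` into itself. -/
structure IsSublinMonoTrans {p : ℝ≥0∞} (T : LpI p → LpI p) : Prop where
  subadditive : ∀ f g : LpI p, T (f + g) ≤ T f + T g
  posHomogeneous : ∀ (α : ℝ) (f : LpI p), 0 ≤ α → T (α • f) = α • T f
  translatable : ∀ (f : LpI p) (α : ℝ), T (f + α • e0 p) = T f + α • T (e0 p)
  monotone : ∀ f g : LpI p, f ≤ g → T f ≤ T g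

/-- `G` is a version of the family `Φ` of elements of `L_p([0, 1])` which is continuous in the
parameter `ξ ∈ [0, 1]`: each `G ξ` represents the class `Φ ξ`, and for almost every `y` the
function `ξ ↦ G ξ y` is continuous on `[0, 1]`. -/
def IsContinuousVersion {p : ℝ≥0∞} (Φ : ℝ → LpI p) (G : ℝ → ℝ → ℝ) : Prop :=
  (∀ ξ ∈ Icc (0 : ℝ) 1, G ξ =ᵐ[muI] Φ ξ) ∧
    ∀ᵐ y ∂muI, ContinuousOn (fun ξ => G ξ y) (Icc (0 : ℝ) 1)

/-- The dyadic number `⌊2^m ξ⌋ / 2^m`. -/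
def dyadic (m : ℕ) (ξ : ℝ) : ℝ := (⌊(2 : ℝ) ^ m * ξ⌋ : ℝ) / 2 ^ m

/-- The value at `y` of the member with parameter `ξ` of the family `Φ`, read as the limit of the
values at `y` of the members with the dyadic parameters that approximate `ξ`. -/
def versionAt {p : ℝ≥0∞} (Φ : ℝ → LpI p) (ξ y : ℝ) : ℝ :=
  limUnder atTop (fun m : ℕ => (Φ (dyadic m ξ) : ℝ → ℝ) y)

/-- The function `x ↦ Φ_x(x)` of a family `Φ` of elements of `L_p([0, 1])`. -/
def diagonal {p : ℝ≥0∞} (Φ : ℝ → LpI p) (x : ℝ) : ℝ := versionAt Φ x x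

/-- The function `x ↦ T((e_1 - x)^2)(x)`. -/
def secondMoment {p : ℝ≥0∞} (T : LpI p → LpI p) : ℝ → ℝ :=
  diagonal (fun ξ => T (sqShift p ξ))

/-- The quantity `μ = ‖T((e_1 - x)^2)(x)‖_∞`. -/
def muT {p : ℝ≥0∞} (T : LpI p → LpI p) : ℝ≥0∞ := eLpNorm (secondMoment T) ∞ muI

/-- The quantity
`s = (max {‖T(e_0) - e_0‖_p, ‖[T((e_1 - x)^2)(x)]^{1/2}‖_p, μ})^{1/2}`. -/
def sT {p : ℝ≥0∞} (T : LpI p → LpI p) : ℝ≥0∞ :=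
  (max (max (eLpNorm (T (e0 p) - e0 p : LpI p) p muI)
      (eLpNorm (fun x => Real.sqrt (secondMoment T x)) p muI)) (muT T)) ^ (1 / 2 : ℝ)

/-- The second order modulus of smoothness in `L_p([0, 1])`:
the supremum over `|h| ≤ δ` of the `L_p` norm of `x ↦ f(x + 2h) - 2 f(x + h) + f(x)`,
taken over those `x ∈ [0, 1]` for which `x + 2h ∈ [0, 1]`. -/
def omega2 {p : ℝ≥0∞} (f : LpI p) (δ : ℝ≥0∞) : ℝ≥0∞ :=
  ⨆ (h : ℝ) (_ : ENNReal.ofReal |h| ≤ δ),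
    eLpNorm (fun x => f (x + 2 * h) - 2 * f (x + h) + f x) p
      (volume.restrict {x : ℝ | x ∈ Icc (0 : ℝ) 1 ∧ x + 2 * h ∈ Icc (0 : ℝ) 1})

/-! The function `x ↦ T((e_1 - x)^2)(x)` is well defined almost everywhere. -/

theorem dyadic_mem (m : ℕ) {ξ : ℝ} (hξ : ξ ∈ Icc (0 : ℝ) 1) : dyadic m ξ ∈ Icc (0 : ℝ) 1 := by
  have h2 : (0 : ℝ) < 2 ^ m := by positivity
  have h0 : (0 : ℝ) ≤ (⌊(2 : ℝ) ^ m * ξ⌋ : ℝ) := by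
    exact_mod_cast Int.floor_nonneg.2 (mul_nonneg h2.le hξ.1)
  refine ⟨div_nonneg h0 h2.le, ?_⟩
  rw [dyadic, div_le_one h2]
  exact (Int.floor_le _).trans (by nlinarith [hξ.2])

theorem abs_dyadic_sub (m : ℕ) (ξ : ℝ) : |dyadic m ξ - ξ| ≤ (1 / 2 : ℝ) ^ m := by
  have h2 : (0 : ℝ) < 2 ^ m := by positivity
  have h : dyadic m ξ - ξ = ((⌊(2 : ℝ) ^ m * ξ⌋ : ℝ) - 2 ^ m * ξ) / 2 ^ m := by
    rw [dyadic]; field_simp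
  rw [h, abs_div, abs_of_pos h2, one_div, inv_pow, div_eq_mul_inv]
  refine mul_le_of_le_one_left (by positivity) ?_
  rw [abs_le]
  constructor <;> linarith [Int.floor_le ((2 : ℝ) ^ m * ξ), Int.lt_floor_add_one ((2 : ℝ) ^ m * ξ)]

theorem tendsto_dyadic (ξ : ℝ) : Tendsto (fun m => dyadic m ξ) atTop (𝓝 ξ) := by
  rw [tendsto_iff_norm_sub_tendsto_zero]
  exact squeeze_zero (fun _ => norm_nonneg _) (fun m => abs_dyadic_sub m ξ)
    (tendsto_pow_atTop_nhds_zero_of_lt_one (by norm_num) (by norm_num))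

/-- The dyadic rationals. -/
def dyadics : Set ℝ := range (fun q : ℤ × ℕ => (q.1 : ℝ) / 2 ^ q.2)

theorem dyadic_mem_dyadics (m : ℕ) (ξ : ℝ) : dyadic m ξ ∈ dyadics :=
  ⟨(⌊(2 : ℝ) ^ m * ξ⌋, m), rfl⟩

theorem countable_dyadics : dyadics.Countable := countable_range _

/-- If a family has a version that is continuous in the parameter, then its diagonal is the diagonal
of that version. -/
theorem diagonal_eq_of_isContinuousVersion {p : ℝ≥0∞} {Φ : ℝ → LpI p} {G : ℝ → ℝ → ℝ}
    (hG : IsContinuousVersion Φ G) : diagonal Φ =ᵐ[muI] fun x => G x x := by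
  have h1 : ∀ᵐ y ∂muI, ∀ ξ ∈ dyadics ∩ Icc 0 1, G ξ y = (Φ ξ : ℝ → ℝ) y :=
    (ae_ball_iff (countable_dyadics.mono inter_subset_left)).2 fun ξ hξ => hG.1 ξ hξ.2
  filter_upwards [h1, hG.2, ae_restrict_mem measurableSet_Icc] with y hy hc hyI
  refine Tendsto.limUnder_eq ?_
  have h2 : Tendsto (fun m => G (dyadic m y) y) atTop (𝓝 (G y y)) :=
    (hc y hyI).tendsto.comp (tendsto_nhdsWithin_iff.2
      ⟨tendsto_dyadic y, Eventually.of_forall fun m => dyadic_mem m hyI⟩)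
  exact h2.congr fun m => hy _ ⟨dyadic_mem_dyadics m y, dyadic_mem m hyI⟩

theorem sqShift_le {p : ℝ≥0∞} {ξ η : ℝ} (hξ : ξ ∈ Icc (0 : ℝ) 1) (hη : η ∈ Icc (0 : ℝ) 1) :
    sqShift p ξ ≤ sqShift p η + (2 * |ξ - η|) • e0 p := by
  rw [← Lp.coeFn_le]
  filter_upwards [Lp.coeFn_add (sqShift p η) ((2 * |ξ - η|) • e0 p),
    Lp.coeFn_smul (2 * |ξ - η|) (e0 p), (memLp_sq p ξ).coeFn_toLp, (memLp_sq p η).coeFn_toLp,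
    Lp.coeFn_const (p := p) (μ := muI) (1 : ℝ), ae_restrict_mem measurableSet_Icc]
    with t h1 h2 h3 h4 h5 ht
  have h5' : (e0 p : ℝ → ℝ) t = 1 := h5
  have h3' : (sqShift p ξ : ℝ → ℝ) t = (t - ξ) ^ 2 := h3
  have h4' : (sqShift p η : ℝ → ℝ) t = (t - η) ^ 2 := h4
  rw [h1, Pi.add_apply, h2, Pi.smul_apply, h3', h4', h5', smul_eq_mul, mul_one]
  have h6 : (t - ξ) ^ 2 - (t - η) ^ 2 = (ξ - η) * (ξ + η - 2 * t) := by ring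
  have h7 : (ξ - η) * (ξ + η - 2 * t) ≤ |ξ - η| * 2 := by
    refine (le_abs_self _).trans ?_
    rw [abs_mul]
    refine mul_le_mul_of_nonneg_left ?_ (abs_nonneg _)
    rw [abs_le]
    constructor <;> linarith [hξ.1, hξ.2, hη.1, hη.2, ht.1, ht.2]
  linarith

theorem apply_sqShift_le {p : ℝ≥0∞} {T : LpI p → LpI p} (hT : IsSublinMonoTrans T) {ξ η : ℝ}
    (hξ : ξ ∈ Icc (0 : ℝ) 1) (hη : η ∈ Icc (0 : ℝ) 1) :
    ∀ᵐ y ∂muI, (T (sqShift p ξ) : ℝ → ℝ) y ≤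
      (T (sqShift p η) : ℝ → ℝ) y + 2 * |ξ - η| * (T (e0 p) : ℝ → ℝ) y := by
  have h := hT.monotone _ _ (sqShift_le (p := p) hξ hη)
  rw [hT.translatable, ← Lp.coeFn_le] at h
  filter_upwards [h, Lp.coeFn_add (T (sqShift p η)) ((2 * |ξ - η|) • T (e0 p)),
    Lp.coeFn_smul (2 * |ξ - η|) (T (e0 p))] with y h1 h2 h3
  rwa [h2, Pi.add_apply, h3, Pi.smul_apply, smul_eq_mul] at h1

/-- For an operator `T` as above, the family `ξ ↦ T((e_1 - ξ)^2)` has a version that is continuous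
in the parameter. -/
theorem isContinuousVersion_versionAt {p : ℝ≥0∞} {T : LpI p → LpI p}
    (hT : IsSublinMonoTrans T) :
    IsContinuousVersion (fun ξ => T (sqShift p ξ)) (versionAt fun ξ => T (sqShift p ξ)) := by
  have key : ∀ S : Set ℝ, S.Countable → S ⊆ Icc 0 1 → ∀ᵐ y ∂muI, ∀ ξ ∈ S, ∀ η ∈ S,
      |(T (sqShift p ξ) : ℝ → ℝ) y - (T (sqShift p η) : ℝ → ℝ) y|
        ≤ 2 * |ξ - η| * |(T (e0 p) : ℝ → ℝ) y| := by
    intro S hS hSI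
    refine (ae_ball_iff hS).2 fun ξ hξ => (ae_ball_iff hS).2 fun η hη => ?_
    filter_upwards [apply_sqShift_le hT (hSI hξ) (hSI hη),
      apply_sqShift_le hT (hSI hη) (hSI hξ)] with y h1 h2
    rw [abs_sub_comm η ξ] at h2
    have h3 := mul_le_mul_of_nonneg_left (le_abs_self ((T (e0 p) : ℝ → ℝ) y))
      (mul_nonneg zero_le_two (abs_nonneg (ξ - η)))
    rw [abs_le]
    constructor <;> linarith
  have hD : (dyadics ∩ Icc 0 1).Countable := countable_dyadics.mono inter_subset_left
  have hpow : Tendsto (fun m : ℕ => (1 / 2 : ℝ) ^ m) atTop (𝓝 0) :=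
    tendsto_pow_atTop_nhds_zero_of_lt_one (by norm_num) (by norm_num)
  refine ⟨fun ξ hξ => ?_, ?_⟩
  · filter_upwards [key (insert ξ (dyadics ∩ Icc 0 1)) (hD.insert ξ)
      (insert_subset hξ inter_subset_right)] with y hy
    refine Tendsto.limUnder_eq ?_
    rw [tendsto_iff_norm_sub_tendsto_zero]
    refine squeeze_zero (fun _ => norm_nonneg _)
      (g := fun m => 2 * (1 / 2 : ℝ) ^ m * |(T (e0 p) : ℝ → ℝ) y|) (fun m => ?_) ?_
    · refine (hy _ (mem_insert_of_mem _ ⟨dyadic_mem_dyadics m ξ, dyadic_mem m hξ⟩) _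
        (mem_insert _ _)).trans ?_
      have := abs_dyadic_sub m ξ
      gcongr
    · simpa using (hpow.const_mul 2).mul_const |(T (e0 p) : ℝ → ℝ) y|
  · filter_upwards [key _ hD inter_subset_right] with y hy
    set L : ℝ := |(T (e0 p) : ℝ → ℝ) y| with hL
    have hmem : ∀ m, ∀ ξ ∈ Icc (0 : ℝ) 1, dyadic m ξ ∈ dyadics ∩ Icc 0 1 :=
      fun m ξ hξ => ⟨dyadic_mem_dyadics m ξ, dyadic_mem m hξ⟩
    have hlim : ∀ ξ ∈ Icc (0 : ℝ) 1,
        Tendsto (fun m : ℕ => (T (sqShift p (dyadic m ξ)) : ℝ → ℝ) y) atTop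
          (𝓝 (versionAt (fun ξ => T (sqShift p ξ)) ξ y)) := by
      intro ξ hξ
      refine CauchySeq.tendsto_limUnder ?_
      refine Metric.cauchySeq_iff.2 fun ε hε => ?_
      have hc := Metric.cauchySeq_iff.1 (tendsto_dyadic ξ).cauchySeq (ε / (2 * L + 1))
        (div_pos hε (by positivity))
      obtain ⟨N, hN⟩ := hc
      refine ⟨N, fun m hm n hn => ?_⟩
      have h1 := hN m hm n hn
      rw [Real.dist_eq] at h1 ⊢
      refine (hy _ (hmem m ξ hξ) _ (hmem n ξ hξ)).trans_lt ?_
      rw [lt_div_iff₀ (by positivity)] at h1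
      nlinarith [abs_nonneg (dyadic m ξ - dyadic n ξ), abs_nonneg ((T (e0 p) : ℝ → ℝ) y)]
    refine (LipschitzOnWith.of_dist_le_mul (K := ⟨2 * L, by positivity⟩) ?_).continuousOn
    intro ξ hξ η hη
    rw [Real.dist_eq, Real.dist_eq]
    refine le_of_tendsto_of_tendsto ((hlim ξ hξ).sub (hlim η hη)).abs
      ((((tendsto_dyadic ξ).sub (tendsto_dyadic η)).abs).const_mul (2 * L)) ?_
    refine Eventually.of_forall fun m => ?_
    refine (hy _ (hmem m ξ hξ) _ (hmem m η hη)).trans (le_of_eq ?_)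
    change _ = 2 * L * |dyadic m ξ - dyadic m η|
    ring

end SublinearApprox

end

/-! The argument is of K-functional type. At the scale `s = s_{n,p}` the function `f` is replaced by
a smooth `g`, and `T f - T g`, `T g - g`, `g - f` are estimated separately. Monotonicity and
subadditivity give `|T f - T g| ≤ T |f - g|`, so `T` is Lipschitz (`norm_apply_sub_apply_le`). The
function `g` combines two Steklov means of `f`, with `‖f - g‖ ≤ 4 ω` and `s² ‖g''‖ ≤ 144 ω`
(`eLpNorm_sub_steklov_le`, `eLpNorm_steklovDD_le`).

For smooth `g`, Taylor's formula at `y` bounds `|g t - g y|` by `|g' y| |t - y| + 2 M(g'')(y) (t -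
y)²`, where `M` is the Hardy–Littlewood maximal function. Passing this through `T` at the point `y`
involves only `T e₀` and the second moment `m` (`ae_quadratic_bounds`, `ae_abs_apply_sub_le`): the
first order term costs `√m` and `|T e₀ - 1|`, the remainder costs `M(g'') m`. Since `g` and `g'` are
bounded by the `L₁` norms of `g` and `g''` (`abs_deriv_le`), `M` is bounded on `L_p` for `p > 1`
(`maximalFn_strong_type`) and `m ≤ μ`, the errors are governed by the three entries of the maximum
defining `s²` (`eLpNorm_apply_sub_le`).

This settles `0 < s < 1`. For `s ≥ 1` the boundedness of `T` suffices. For `s = 0` there is no scale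
to smooth at, and a Korovkin argument shows that `T` is the identity (`apply_eq_self`). -/

noncomputable section

namespace SublinearApprox

/-! ### The Hardy–Littlewood maximal inequality on the line. -/

/-- The centred Hardy–Littlewood maximal function on the line, taken over rational radii. -/
def maximalFn (φ : ℝ → ℝ≥0∞) (y : ℝ) : ℝ≥0∞ :=
  ⨆ (r : ℚ) (_ : 0 < r), (∫⁻ x in Metric.closedBall y (r : ℝ), φ x) / ENNReal.ofReal (2 * r)

theorem measurable_maximalFn {φ : ℝ → ℝ≥0∞} (hφ : Measurable φ) : Measurable (maximalFn φ) := by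
  refine Measurable.iSup fun r => Measurable.iSup fun _ => Measurable.div_const ?_ _
  have h1 : (fun y => ∫⁻ x in Metric.closedBall y (r : ℝ), φ x) =
      fun y => ∫⁻ x, {z : ℝ × ℝ | dist z.2 z.1 ≤ r}.indicator (fun z => φ z.2) (y, x) := by
    funext y
    rw [← lintegral_indicator Metric.isClosed_closedBall.measurableSet]
    rfl
  rw [h1]
  exact Measurable.lintegral_prod_right' ((hφ.comp measurable_snd).indicator
    (measurableSet_le (by fun_prop) measurable_const))

theorem lintegral_closedBall_le_maximalFn (φ : ℝ → ℝ≥0∞) (y : ℝ) {r : ℝ} (hr : 0 ≤ r) :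
    ∫⁻ x in Metric.closedBall y r, φ x ≤ ENNReal.ofReal (2 * r) * maximalFn φ y := by
  obtain ⟨u, -, hu, hlim⟩ := Real.exists_seq_rat_strictAnti_tendsto r
  -- Multiplication by `∞` is not continuous at `0`, so this case is kept out of the limit over
  -- rational radii decreasing to `r`.
  rcases eq_or_ne (maximalFn φ y) ∞ with hM | hM
  · rcases hr.eq_or_lt with rfl | hr'
    · simp [Metric.closedBall_zero]
    · rw [hM, ENNReal.mul_top (by simpa using hr')]
      exact le_top
  have hle : ∀ n, ∫⁻ x in Metric.closedBall y r, φ x ≤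
      ENNReal.ofReal (2 * u n) * maximalFn φ y := by
    intro n
    have hpos : (0 : ℝ) < u n := hr.trans_lt (hu n)
    have h0 : 0 < u n := by exact_mod_cast hpos
    have h1 : (∫⁻ x in Metric.closedBall y (u n : ℝ), φ x) / ENNReal.ofReal (2 * u n) ≤
        maximalFn φ y := le_iSup₂_of_le (u n) h0 le_rfl
    have h2 : ENNReal.ofReal (2 * u n) ≠ 0 := by
      simpa using hpos
    rw [ENNReal.div_le_iff h2 ENNReal.ofReal_ne_top, mul_comm] at h1
    exact (lintegral_mono_set (Metric.closedBall_subset_closedBall (hu n).le)).trans h1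
  have hlim' : Tendsto (fun n => ENNReal.ofReal (2 * (u n : ℝ)) * maximalFn φ y) atTop
      (𝓝 (ENNReal.ofReal (2 * r) * maximalFn φ y)) :=
    ENNReal.Tendsto.mul_const
      ((ENNReal.continuous_ofReal.tendsto _).comp (hlim.const_mul 2)) (Or.inr hM)
  exact ge_of_tendsto' hlim' hle

/-- Each point of the level set is the centre of a ball on which `φ` has average above `l`.
Finiteness of the integral bounds the radii, so Vitali's lemma yields disjoint balls whose fourfold
enlargements cover the set; the enlargement factor is the constant 4. -/
theorem maximalFn_weak_type {φ : ℝ → ℝ≥0∞} {l : ℝ≥0∞} (hl : l ≠ ∞) (hl0 : l ≠ 0) :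
    l * volume {y | l < maximalFn φ y} ≤ 4 * ∫⁻ x, φ x := by
  rcases eq_or_ne (∫⁻ x, φ x) ∞ with hI | hI
  · rw [hI, ENNReal.mul_top (by norm_num)]
    exact le_top
  set t : Set (ℝ × ℝ) :=
    {z | 0 < z.2 ∧ l * ENNReal.ofReal (2 * z.2) < ∫⁻ x in Metric.closedBall z.1 z.2, φ x} with ht
  have hbd : ∀ a ∈ t, a.2 ≤ (∫⁻ x, φ x).toReal / l.toReal := by
    intro a ha
    have h1 : l * ENNReal.ofReal (2 * a.2) ≤ ∫⁻ x, φ x := ha.2.le.trans (setLIntegral_le_lintegral _ _)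
    have h2 := ENNReal.toReal_mono hI h1
    rw [ENNReal.toReal_mul, ENNReal.toReal_ofReal (by linarith [ha.1])] at h2
    rw [le_div_iff₀ (ENNReal.toReal_pos hl0 hl)]
    nlinarith [ha.1, ENNReal.toReal_pos hl0 hl]
  obtain ⟨u, hut, hdisj, hcov⟩ := Vitali.exists_disjoint_subfamily_covering_enlargement_closedBall
    t (fun a => a.1) (fun a => a.2) _ hbd 4 (by norm_num)
  have hcount : u.Countable := by
    refine hdisj.countable_of_nonempty_interior fun a ha => ?_
    rw [interior_closedBall _ (hut ha).1.ne']
    exact Metric.nonempty_ball.2 (hut ha).1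
  have hsub : {y | l < maximalFn φ y} ⊆ ⋃ a ∈ u, Metric.closedBall a.1 (4 * a.2) := by
    intro y hy
    obtain ⟨r, hr⟩ := lt_iSup_iff.1 (show l < maximalFn φ y from hy)
    obtain ⟨hr0, hr⟩ := lt_iSup_iff.1 hr
    have hr0' : (0 : ℝ) < r := by exact_mod_cast hr0
    have hmem : (y, (r : ℝ)) ∈ t := by
      refine ⟨hr0', ?_⟩
      rwa [ENNReal.lt_div_iff_mul_lt (Or.inl (by simpa using hr0')) (Or.inl ENNReal.ofReal_ne_top)]
        at hr
    obtain ⟨b, hb, hyb⟩ := hcov _ hmem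
    exact mem_iUnion₂.2 ⟨b, hb, hyb (Metric.mem_closedBall_self hr0'.le)⟩
  calc l * volume {y | l < maximalFn φ y}
      ≤ l * ∑' a : u, volume (Metric.closedBall (a : ℝ × ℝ).1 (4 * (a : ℝ × ℝ).2)) := by
        gcongr
        exact (measure_mono hsub).trans (measure_biUnion_le _ hcount _)
    _ = ∑' a : u, 4 * (l * ENNReal.ofReal (2 * (a : ℝ × ℝ).2)) := by
        rw [← ENNReal.tsum_mul_left]
        congr 1
        funext a
        rw [Real.volume_closedBall, show (2 : ℝ) * (4 * (a : ℝ × ℝ).2) = 4 * (2 * (a : ℝ × ℝ).2)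
          by ring, ENNReal.ofReal_mul (by norm_num)]
        norm_num
        ring
    _ ≤ ∑' a : u, 4 * ∫⁻ x in Metric.closedBall (a : ℝ × ℝ).1 (a : ℝ × ℝ).2, φ x := by
        gcongr with a
        exact (hut a.2).2.le
    _ = 4 * ∫⁻ x in ⋃ a ∈ u, Metric.closedBall a.1 a.2, φ x := by
        rw [ENNReal.tsum_mul_left, lintegral_biUnion hcount
          (fun a _ => Metric.isClosed_closedBall.measurableSet) hdisj]
    _ ≤ 4 * ∫⁻ x, φ x := by
        gcongr
        exact Measure.restrict_le_self

/-- Truncation: the part of `φ` not exceeding `c` contributes at most `c` to any average. With `c =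
t / 2` only the large part of `φ` matters at level `t`. -/
theorem maximalFn_le_add_const (φ : ℝ → ℝ≥0∞) (c : ℝ≥0∞) (y : ℝ) :
    maximalFn φ y ≤ maximalFn ({x | c < φ x}.indicator φ) y + c := by
  refine iSup₂_le fun r hr => ?_
  have hr' : (0 : ℝ) < r := by exact_mod_cast hr
  have h0 : ENNReal.ofReal (2 * (r : ℝ)) ≠ 0 := by simpa using hr'
  have h1 : ∫⁻ x in Metric.closedBall y (r : ℝ), φ x ≤
      (∫⁻ x in Metric.closedBall y (r : ℝ), {x | c < φ x}.indicator φ x) +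
        c * ENNReal.ofReal (2 * r) := by
    rw [← Real.volume_closedBall (a := y), ← setLIntegral_const, ← lintegral_add_right _
      measurable_const]
    refine lintegral_mono fun x => ?_
    by_cases hx : c < φ x
    · simp [indicator, hx]
    · exact (not_lt.1 hx).trans le_add_self
  calc _ ≤ ((∫⁻ x in Metric.closedBall y (r : ℝ), {x | c < φ x}.indicator φ x) +
        c * ENNReal.ofReal (2 * r)) / ENNReal.ofReal (2 * r) := by gcongr
    _ = (∫⁻ x in Metric.closedBall y (r : ℝ), {x | c < φ x}.indicator φ x) /
          ENNReal.ofReal (2 * r) + c := by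
        rw [ENNReal.add_div, ENNReal.mul_div_cancel_right h0 ENNReal.ofReal_ne_top]
    _ ≤ _ := by
        gcongr
        exact le_iSup₂_of_le r hr le_rfl

theorem maximalFn_ae_lt_top {φ : ℝ → ℝ≥0∞} (hI : ∫⁻ x, φ x ≠ ∞) :
    ∀ᵐ y, maximalFn φ y < ∞ := by
  rw [ae_iff]
  by_contra hne
  have hsub : ∀ n : ℕ, (n + 1 : ℝ≥0∞) * volume {y | ¬ maximalFn φ y < ∞} ≤ 4 * ∫⁻ x, φ x := by
    intro n
    refine le_trans ?_ (maximalFn_weak_type (φ := φ) (l := n + 1)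
      (by finiteness) (by simp))
    refine mul_le_mul_right (measure_mono fun y hy => ?_) _
    have hy' : maximalFn φ y = ∞ := top_le_iff.1 (not_lt.1 hy)
    change _ < maximalFn φ y
    rw [hy']
    finiteness
  have hfin : (4 * ∫⁻ x, φ x) / volume {y | ¬ maximalFn φ y < ∞} ≠ ∞ :=
    ENNReal.div_ne_top (ENNReal.mul_ne_top (by norm_num) hI) hne
  obtain ⟨n, hn⟩ := ENNReal.exists_nat_gt hfin
  rw [ENNReal.div_lt_iff (Or.inl hne) (Or.inr (ENNReal.mul_ne_top (by norm_num) hI))] at hn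
  refine absurd (hn.trans_le ?_) (hsub n).not_gt
  gcongr
  exact le_self_add

/-- Marcinkiewicz interpolation by hand: layer-cake formula, the weak type bound at height `t / 2`
for `q` restricted to `t < 2 |q|`, and Tonelli. The inner integral of `t ^ (p - 2)` over `(0, 2 |q
x|)` converges because `p > 1`. -/
theorem maximalFn_strong_type {q : ℝ → ℝ} (hq : Measurable q) (hI : Integrable q)
    {p : ℝ} (hp : 1 < p) :
    ∫⁻ y, maximalFn (fun x => ‖q x‖ₑ) y ^ p ≤
      ENNReal.ofReal (p * (8 * 2 ^ (p - 1) / (p - 1))) * ∫⁻ x, ‖q x‖ₑ ^ p := by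
  set φ : ℝ → ℝ≥0∞ := fun x => ‖q x‖ₑ with hφdef
  have hφ : Measurable φ := hq.enorm
  have hfin := maximalFn_ae_lt_top (φ := φ) hI.2.ne
  have hp1 : 0 < p - 1 := by linarith
  have hlevel : ∀ t : ℝ, 0 < t → volume {y | t < (maximalFn φ y).toReal} *
      ENNReal.ofReal (t ^ (p - 1)) ≤
        ∫⁻ x, ENNReal.ofReal (8 * t ^ (p - 2)) * {x | t < 2 * |q x|}.indicator φ x := by
    intro t ht
    have h2 : ENNReal.ofReal (t / 2) ≠ 0 := by simpa using ht
    have hsub : {y | t < (maximalFn φ y).toReal} ⊆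
        {y | ENNReal.ofReal (t / 2) <
          maximalFn ({x | ENNReal.ofReal (t / 2) < φ x}.indicator φ) y} := by
      intro y hy
      have hy1 : ENNReal.ofReal t < maximalFn φ y := by
        refine (ENNReal.ofReal_lt_ofReal_iff (ht.trans hy)).2 hy |>.trans_le ENNReal.ofReal_toReal_le
      have hy2 := hy1.trans_le (maximalFn_le_add_const φ (ENNReal.ofReal (t / 2)) y)
      by_contra hcon
      have hcon' := not_lt.1 (show ¬ ENNReal.ofReal (t / 2) < _ from hcon)
      refine hy2.not_ge ((add_le_add_left hcon' _).trans ?_)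
      rw [← ENNReal.ofReal_add (by positivity) (by positivity), add_halves]
    have hset : {x | ENNReal.ofReal (t / 2) < φ x} = {x | t < 2 * |q x|} := by
      ext x
      simp only [mem_ofPred_eq, hφdef, ← ofReal_norm, Real.norm_eq_abs]
      constructor
      · intro h
        have := (ENNReal.ofReal_lt_ofReal_iff_of_nonneg (by positivity)).1 h
        linarith
      · intro h
        exact (ENNReal.ofReal_lt_ofReal_iff_of_nonneg (by positivity)).2 (by linarith)
    have hw := maximalFn_weak_type (φ := {x | ENNReal.ofReal (t / 2) < φ x}.indicator φ)
      ENNReal.ofReal_ne_top h2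
    rw [hset] at hw hsub
    -- The factor `t / 2` is the level in the weak type bound; the remaining 2 times the weak type
    -- constant 4 gives the 8.
    have hpow : t ^ (p - 1) = (2 * t ^ (p - 2)) * (t / 2) := by
      have : t ^ (p - 1) = t ^ (p - 2) * t := by
        rw [← Real.rpow_add_one ht.ne']; congr 1; ring
      rw [this]; ring
    rw [lintegral_const_mul' _ _ ENNReal.ofReal_ne_top]
    calc _ ≤ volume {y | ENNReal.ofReal (t / 2) <
          maximalFn ({x | t < 2 * |q x|}.indicator φ) y} * ENNReal.ofReal (t ^ (p - 1)) := by
          gcongr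
      _ = ENNReal.ofReal (2 * t ^ (p - 2)) * (ENNReal.ofReal (t / 2) *
          volume {y | ENNReal.ofReal (t / 2) <
            maximalFn ({x | t < 2 * |q x|}.indicator φ) y}) := by
          rw [hpow, ENNReal.ofReal_mul (by positivity)]; ring
      _ ≤ ENNReal.ofReal (2 * t ^ (p - 2)) *
          (4 * ∫⁻ x, {x | t < 2 * |q x|}.indicator φ x) := by gcongr
      _ = _ := by
          rw [← mul_assoc]
          congr 1
          rw [show (8 : ℝ) * t ^ (p - 2) = (2 * t ^ (p - 2)) * 4 by ring,
            ENNReal.ofReal_mul (p := 2 * t ^ (p - 2)) (by positivity)]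
          norm_num
  have hinner : ∀ x : ℝ, ∫⁻ t in Ioi (0 : ℝ), ENNReal.ofReal (8 * t ^ (p - 2)) *
      {x | t < 2 * |q x|}.indicator φ x =
        ENNReal.ofReal (8 * 2 ^ (p - 1) / (p - 1)) * φ x ^ p := by
    intro x
    have h1 : ∀ t : ℝ, ENNReal.ofReal (8 * t ^ (p - 2)) * {x | t < 2 * |q x|}.indicator φ x =
        (Iio (2 * |q x|)).indicator (fun t => ENNReal.ofReal (8 * t ^ (p - 2))) t * φ x := by
      intro t
      by_cases ht : t < 2 * |q x|
      · simp [indicator, ht]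
      · simp [indicator, ht]
    simp_rw [h1]
    rw [lintegral_mul_const' _ _ (by simp [hφdef]), lintegral_indicator measurableSet_Iio,
      Measure.restrict_restrict measurableSet_Iio, Iio_inter_Ioi]
    have h0 : (0 : ℝ) ≤ 2 * |q x| := by positivity
    rw [restrict_Ioo_eq_restrict_Ioc, ← ofReal_integral_eq_lintegral_ofReal]
    · rw [← intervalIntegral.integral_of_le h0, intervalIntegral.integral_const_mul,
        integral_rpow (Or.inl (by linarith)), show p - 2 + 1 = p - 1 by ring,
        Real.zero_rpow hp1.ne', sub_zero, Real.mul_rpow (by norm_num) (abs_nonneg _)]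
      have h3 : φ x = ENNReal.ofReal |q x| := by
        simp only [hφdef, ← ofReal_norm, Real.norm_eq_abs]
      rw [h3, ENNReal.ofReal_rpow_of_nonneg (abs_nonneg _) (by linarith),
        ← ENNReal.ofReal_mul (mul_nonneg (by norm_num) (div_nonneg (by positivity) hp1.le)),
        ← ENNReal.ofReal_mul (div_nonneg (by positivity) hp1.le)]
      congr 1
      have h4 : |q x| ^ p = |q x| ^ (p - 1) * |q x| := by
        rcases (abs_nonneg (q x)).eq_or_lt with h | h
        · rw [← h, Real.zero_rpow (by linarith)]; simp
        · rw [← Real.rpow_add_one h.ne']; congr 1; ring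
      rw [h4]; ring
    · have := (intervalIntegral.intervalIntegrable_rpow' (a := 0) (b := 2 * |q x|)
        (r := p - 2) (by linarith)).const_mul 8
      rwa [intervalIntegrable_iff_integrableOn_Ioc_of_le h0] at this
    · filter_upwards [ae_restrict_mem measurableSet_Ioc] with t ht
      have := ht.1
      positivity
  calc ∫⁻ y, maximalFn φ y ^ p
      = ∫⁻ y, ENNReal.ofReal ((maximalFn φ y).toReal ^ p) := by
        refine lintegral_congr_ae ?_
        filter_upwards [hfin] with y hy
        rw [← ENNReal.ofReal_rpow_of_nonneg ENNReal.toReal_nonneg (by linarith),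
          ENNReal.ofReal_toReal hy.ne]
    _ = ENNReal.ofReal p * ∫⁻ t in Ioi 0, volume {y | t < (maximalFn φ y).toReal} *
          ENNReal.ofReal (t ^ (p - 1)) :=
        lintegral_rpow_eq_lintegral_meas_lt_mul _ (Eventually.of_forall fun _ =>
          ENNReal.toReal_nonneg) (measurable_maximalFn hφ).ennreal_toReal.aemeasurable
          (by linarith)
    _ ≤ ENNReal.ofReal p * ∫⁻ t in Ioi (0 : ℝ), ∫⁻ x,
          ENNReal.ofReal (8 * t ^ (p - 2)) * {x | t < 2 * |q x|}.indicator φ x := by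
        refine mul_le_mul_right ?_ _
        exact setLIntegral_mono_ae' measurableSet_Ioi
          (Eventually.of_forall fun t ht => hlevel t ht)
    _ = ENNReal.ofReal p * ∫⁻ x, ∫⁻ t in Ioi (0 : ℝ),
          ENNReal.ofReal (8 * t ^ (p - 2)) * {x | t < 2 * |q x|}.indicator φ x := by
        rw [lintegral_lintegral_swap]
        refine Measurable.aemeasurable ?_
        have h5 : Measurable (fun z : ℝ × ℝ =>
            {z : ℝ × ℝ | z.1 < 2 * |q z.2|}.indicator (fun z => φ z.2) z) :=
          (hφ.comp measurable_snd).indicator (measurableSet_lt measurable_fst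
            (by fun_prop))
        exact Measurable.mul (by fun_prop) h5
    _ = _ := by
        simp_rw [hinner]
        rw [lintegral_const_mul' _ _ ENNReal.ofReal_ne_top, ← mul_assoc,
          ← ENNReal.ofReal_mul (by linarith)]

/-! ### Pointwise and norm estimates for sublinear monotone translatable operators. -/

section Operator

variable {p : ℝ≥0∞} {T : LpI p → LpI p}

theorem coeFn_e0 (p : ℝ≥0∞) : (e0 p : ℝ → ℝ) =ᵐ[muI] fun _ => 1 := 
  Lp.coeFn_const (p := p) (μ := muI) (1 : ℝ)

theorem coeFn_sqShift (p : ℝ≥0∞) (ξ : ℝ) : (sqShift p ξ : ℝ → ℝ) =ᵐ[muI] fun t => (t - ξ) ^ 2 :=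
  (memLp_sq p ξ).coeFn_toLp

theorem coeFn_lin (a b : ℝ) (g h : LpI p) :
    ((a • g + b • h : LpI p) : ℝ → ℝ) =ᵐ[muI] fun t => a * g t + b * h t := by
  filter_upwards [Lp.coeFn_add (a • g) (b • h), Lp.coeFn_smul a g, Lp.coeFn_smul b h]
    with t h1 h2 h3
  rw [h1, Pi.add_apply, h2, h3, Pi.smul_apply, Pi.smul_apply, smul_eq_mul, smul_eq_mul]

theorem IsSublinMonoTrans.map_zero (hT : IsSublinMonoTrans T) : T 0 = 0 := by
  simpa using hT.posHomogeneous 0 0 le_rfl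

theorem IsSublinMonoTrans.nonneg (hT : IsSublinMonoTrans T) {g : LpI p} (hg : 0 ≤ g) :
    0 ≤ T g := by
  simpa [hT.map_zero] using hT.monotone 0 g hg

theorem IsSublinMonoTrans.apply_e0_nonneg (hT : IsSublinMonoTrans T) :
    ∀ᵐ y ∂muI, 0 ≤ (T (e0 p) : ℝ → ℝ) y := by
  have h0 : 0 ≤ e0 p := by
    rw [← Lp.coeFn_nonneg]
    filter_upwards [coeFn_e0 p] with t ht
    simp [ht]
  have := hT.nonneg h0
  rwa [← Lp.coeFn_nonneg] at this

theorem IsSublinMonoTrans.apply_le (hT : IsSublinMonoTrans T) {g : LpI p} {γ : ℝ → ℝ}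
    (hg : g =ᵐ[muI] γ) {ξ A K : ℝ} (hA : 0 ≤ A)
    (h : ∀ t ∈ Icc (0 : ℝ) 1, γ t ≤ A * (t - ξ) ^ 2 + K) :
    ∀ᵐ y ∂muI, T g y ≤ A * T (sqShift p ξ) y + K * T (e0 p) y := by
  have h1 : g ≤ A • sqShift p ξ + K • e0 p := by
    rw [← Lp.coeFn_le]
    filter_upwards [hg, coeFn_lin A K (sqShift p ξ) (e0 p), coeFn_sqShift p ξ, coeFn_e0 p,
      ae_restrict_mem measurableSet_Icc] with t h2 h3 h4 h5 ht
    rw [h3, h4, h5, h2, mul_one]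
    exact h t ht
  have h2 := hT.monotone _ _ h1
  rw [hT.translatable, hT.posHomogeneous _ _ hA, ← Lp.coeFn_le] at h2
  filter_upwards [h2, coeFn_lin A K (T (sqShift p ξ)) (T (e0 p))] with y h3 h4
  rwa [h4] at h3

/-- Since `T (-g)` need not be `-T g`, the quadratic is kept on the side of `g`, where subadditivity
splits it off; thus `T` is never applied to a negative multiple of it. -/
theorem IsSublinMonoTrans.le_apply (hT : IsSublinMonoTrans T) {g : LpI p} {γ : ℝ → ℝ}
    (hg : g =ᵐ[muI] γ) {ξ A K : ℝ} (hA : 0 ≤ A)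
    (h : ∀ t ∈ Icc (0 : ℝ) 1, K ≤ γ t + A * (t - ξ) ^ 2) :
    ∀ᵐ y ∂muI, K * T (e0 p) y ≤ T g y + A * T (sqShift p ξ) y := by
  have h1 : (0 : LpI p) + K • e0 p ≤ (1 : ℝ) • g + A • sqShift p ξ := by
    rw [← Lp.coeFn_le, zero_add]
    filter_upwards [hg, coeFn_lin 1 A g (sqShift p ξ), coeFn_sqShift p ξ, coeFn_e0 p,
      Lp.coeFn_smul K (e0 p), ae_restrict_mem measurableSet_Icc] with t h2 h3 h4 h5 h6 ht
    rw [h3, h4, h2, h6, Pi.smul_apply, h5, smul_eq_mul, mul_one, one_mul]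
    exact h t ht
  have h2 := (hT.monotone _ _ h1).trans (hT.subadditive _ _)
  rw [hT.translatable, hT.map_zero, zero_add, hT.posHomogeneous _ _ hA, one_smul,
    ← one_smul ℝ (T g), ← Lp.coeFn_le] at h2
  filter_upwards [h2, coeFn_lin 1 A (T g) (T (sqShift p ξ)), Lp.coeFn_smul K (T (e0 p))]
    with y h3 h4 h5
  rwa [h4, h5, Pi.smul_apply, smul_eq_mul, one_mul] at h3

/-- Off a single null set the continuous version agrees with the classes at all dyadic parameters,
so continuity at `ξ = y` gives the limit. -/
theorem ae_tendsto_secondMoment (hT : IsSublinMonoTrans T) :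
    ∀ᵐ y ∂muI, Tendsto (fun m => T (sqShift p (dyadic m y)) y) atTop (𝓝 (secondMoment T y)) := by
  obtain ⟨h1, h2⟩ := isContinuousVersion_versionAt hT
  have h3 : ∀ᵐ y ∂muI, ∀ ξ ∈ dyadics ∩ Icc 0 1,
      versionAt (fun ξ => T (sqShift p ξ)) ξ y = T (sqShift p ξ) y :=
    (ae_ball_iff (countable_dyadics.mono inter_subset_left)).2 fun ξ hξ => h1 ξ hξ.2
  filter_upwards [h3, h2, ae_restrict_mem measurableSet_Icc] with y hy hc hyI
  have h4 := (hc y hyI).tendsto.comp (tendsto_nhdsWithin_iff.2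
    ⟨tendsto_dyadic y, Eventually.of_forall fun m => dyadic_mem m hyI⟩)
  exact h4.congr fun m => hy _ ⟨dyadic_mem_dyadics m y, dyadic_mem m hyI⟩

theorem secondMoment_nonneg (hT : IsSublinMonoTrans T) : ∀ᵐ y ∂muI, 0 ≤ secondMoment T y := by
  have h3 : ∀ᵐ y ∂muI, ∀ ξ ∈ dyadics, 0 ≤ T (sqShift p ξ) y := by
    refine (ae_ball_iff countable_dyadics).2 fun ξ _ => ?_
    have h0 : 0 ≤ sqShift p ξ := by
      rw [← Lp.coeFn_nonneg]
      filter_upwards [coeFn_sqShift p ξ] with t ht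
      rw [ht]
      exact sq_nonneg _
    have := hT.nonneg h0
    rwa [← Lp.coeFn_nonneg] at this
  filter_upwards [h3, ae_tendsto_secondMoment hT] with y h4 h5
  exact ge_of_tendsto' h5 fun m => h4 _ (dyadic_mem_dyadics m y)

theorem sq_sub_le_sq_sub_dyadic (m : ℕ) {t y : ℝ} (ht : t ∈ Icc (0 : ℝ) 1)
    (hy : y ∈ Icc (0 : ℝ) 1) : (t - y) ^ 2 ≤ (t - dyadic m y) ^ 2 + 2 * (1 / 2 : ℝ) ^ m := by
  have h1 := abs_le.1 (abs_dyadic_sub m y)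
  have h2 := dyadic_mem m hy
  have h3 : (0 : ℝ) ≤ (1 / 2 : ℝ) ^ m := by positivity
  have h4 : |(dyadic m y - y) * (2 * t - y - dyadic m y)| ≤ (1 / 2 : ℝ) ^ m * 2 := by
    rw [abs_mul]
    refine mul_le_mul (abs_dyadic_sub m y) ?_ (abs_nonneg _) h3
    rw [abs_le]
    constructor <;> linarith [ht.1, ht.2, hy.1, hy.2, h2.1, h2.2]
  have h5 := (abs_le.1 h4).2
  nlinarith

/-- Pointwise bounds: at almost every `y`, quadratic bounds centred at `y` pass through `T`. -/
theorem ae_quadratic_bounds (hT : IsSublinMonoTrans T) {g : LpI p} {γ : ℝ → ℝ}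
    (hg : g =ᵐ[muI] γ) :
    ∀ᵐ y ∂muI, ∀ A K : ℝ, 0 ≤ A →
      ((∀ t ∈ Icc (0 : ℝ) 1, γ t ≤ A * (t - y) ^ 2 + K) →
        T g y ≤ A * secondMoment T y + K * T (e0 p) y) ∧
      ((∀ t ∈ Icc (0 : ℝ) 1, K ≤ γ t + A * (t - y) ^ 2) →
        K * T (e0 p) y ≤ T g y + A * secondMoment T y) := by
  -- The exceptional null set of `apply_le` depends on the centre and on both coefficients.
  -- Restricting to dyadic centres and rational coefficients leaves countably many; centre `y` and
  -- real coefficients follow by a limit.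
  have hU : ∀ᵐ y ∂muI, ∀ ξ ∈ dyadics, ∀ A K : ℚ, (0 : ℝ) ≤ A →
      (∀ t ∈ Icc (0 : ℝ) 1, γ t ≤ A * (t - ξ) ^ 2 + K) →
      T g y ≤ A * T (sqShift p ξ) y + K * T (e0 p) y := by
    refine (ae_ball_iff countable_dyadics).2 fun ξ _ => ae_all_iff.2 fun A => ae_all_iff.2 fun K => ?_
    by_cases h : (0 : ℝ) ≤ A ∧ ∀ t ∈ Icc (0 : ℝ) 1, γ t ≤ A * (t - ξ) ^ 2 + K
    · filter_upwards [hT.apply_le hg h.1 h.2] with y hy _ _ using hy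
    · exact Eventually.of_forall fun y h1 h2 => absurd ⟨h1, h2⟩ h
  have hL : ∀ᵐ y ∂muI, ∀ ξ ∈ dyadics, ∀ A K : ℚ, (0 : ℝ) ≤ A →
      (∀ t ∈ Icc (0 : ℝ) 1, K ≤ γ t + A * (t - ξ) ^ 2) →
      K * T (e0 p) y ≤ T g y + A * T (sqShift p ξ) y := by
    refine (ae_ball_iff countable_dyadics).2 fun ξ _ => ae_all_iff.2 fun A => ae_all_iff.2 fun K => ?_
    by_cases h : (0 : ℝ) ≤ A ∧ ∀ t ∈ Icc (0 : ℝ) 1, K ≤ γ t + A * (t - ξ) ^ 2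
    · filter_upwards [hT.le_apply hg h.1 h.2] with y hy _ _ using hy
    · exact Eventually.of_forall fun y h1 h2 => absurd ⟨h1, h2⟩ h
  have hpow : Tendsto (fun m : ℕ => (1 / 2 : ℝ) ^ m) atTop (𝓝 0) :=
    tendsto_pow_atTop_nhds_zero_of_lt_one (by norm_num) (by norm_num)
  filter_upwards [hU, hL, ae_tendsto_secondMoment hT, ae_restrict_mem measurableSet_Icc]
    with y hyU hyL hlim hy A K hA
  obtain ⟨a, -, ha, halim⟩ := Real.exists_seq_rat_strictAnti_tendsto A
  have ha0 : ∀ m, (0 : ℝ) ≤ a m := fun m => hA.trans (ha m).le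
  have hs : ∀ m, ∀ t ∈ Icc (0 : ℝ) 1,
      A * (t - y) ^ 2 ≤ a m * (t - dyadic m y) ^ 2 + 2 * a m * (1 / 2 : ℝ) ^ m := by
    intro m t ht
    have h1 := mul_le_mul (ha m).le (sq_sub_le_sq_sub_dyadic m ht hy) (sq_nonneg _) (ha0 m)
    linarith
  have hmul : Tendsto (fun m => (a m : ℝ) * T (sqShift p (dyadic m y)) y) atTop
      (𝓝 (A * secondMoment T y)) := halim.mul hlim
  have herr : Tendsto (fun m => 2 * (a m : ℝ) * (1 / 2 : ℝ) ^ m) atTop (𝓝 0) := by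
    simpa using (halim.const_mul 2).mul hpow
  refine ⟨fun h => ?_, fun h => ?_⟩
  -- The constant is approximated from above here and from below in the other half, so that the
  -- hypothesis survives; the cost of moving the centre is absorbed into it.
  · obtain ⟨k, -, hk, hklim⟩ := Real.exists_seq_rat_strictAnti_tendsto K
    have hle : ∀ m, T g y ≤ a m * T (sqShift p (dyadic m y)) y +
        ((k m : ℝ) + 2 * a m * (1 / 2 : ℝ) ^ m) * T (e0 p) y := by
      intro m
      have h2 := hyU _ (dyadic_mem_dyadics m y) (a m) (k m + 2 * a m * (1 / 2) ^ m) (ha0 m)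
      push_cast at h2
      exact h2 fun t ht => by linarith [h t ht, hs m t ht, hk m]
    refine ge_of_tendsto' (x := atTop) ?_ hle
    simpa using hmul.add ((hklim.add herr).mul_const (T (e0 p) y))
  · obtain ⟨k, -, hk, hklim⟩ := Real.exists_seq_rat_strictMono_tendsto K
    have hle : ∀ m, ((k m : ℝ) - 2 * a m * (1 / 2 : ℝ) ^ m) * T (e0 p) y ≤
        T g y + a m * T (sqShift p (dyadic m y)) y := by
      intro m
      have h2 := hyL _ (dyadic_mem_dyadics m y) (a m) (k m - 2 * a m * (1 / 2) ^ m) (ha0 m)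
      push_cast at h2
      exact h2 fun t ht => by linarith [h t ht, hs m t ht, hk m]
    refine le_of_tendsto_of_tendsto' (b := atTop) ?_ (hmul.const_add (T g y)) hle
    simpa using (hklim.sub herr).mul_const (T (e0 p) y)

/-- The pointwise error in terms of a first order expansion with quadratic remainder. -/
theorem ae_abs_apply_sub_le (hT : IsSublinMonoTrans T) {g : LpI p} {γ : ℝ → ℝ}
    (hg : g =ᵐ[muI] γ) :
    ∀ᵐ y ∂muI, secondMoment T y ≤ 1 → ∀ A D : ℝ, 0 ≤ A → 0 ≤ D →
      (∀ t ∈ Icc (0 : ℝ) 1, |γ t - γ y| ≤ D * |t - y| + A * (t - y) ^ 2) →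
      |T g y - γ y| ≤ |γ y| * |T (e0 p) y - 1| +
        D * (2 * √(secondMoment T y) + |T (e0 p) y - 1|) + A * secondMoment T y := by
  filter_upwards [ae_quadratic_bounds hT hg, secondMoment_nonneg hT, hT.apply_e0_nonneg]
    with y hy hm he hm1 A D hA hD h
  set m := secondMoment T y
  set e : ℝ := T (e0 p) y
  have hε : ∀ ε : ℝ, 0 < ε → |T g y - γ y * e| ≤
      (D / (2 * ε) + A) * m + D * ε / 2 * e := by
    intro ε hε
    have hA' : 0 ≤ D / (2 * ε) + A := by positivity
    have hq : ∀ t ∈ Icc (0 : ℝ) 1,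
        |γ t - γ y| ≤ (D / (2 * ε) + A) * (t - y) ^ 2 + D * ε / 2 := by
      intro t ht
      refine (h t ht).trans ?_
      -- The arithmetic–geometric mean inequality turns the linear term into an admissible
      -- quadratic, in place of Cauchy–Schwarz.
      have h1 : |t - y| ≤ (t - y) ^ 2 / (2 * ε) + ε / 2 := by
        rw [← sq_abs (t - y), ← sub_nonneg]
        have : |t - y| ^ 2 / (2 * ε) + ε / 2 - |t - y| = (|t - y| - ε) ^ 2 / (2 * ε) := by
          field_simp; ring
        rw [this]
        positivity
      have h2 := mul_le_mul_of_nonneg_left h1 hD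
      have h3 : D * ((t - y) ^ 2 / (2 * ε) + ε / 2) = D / (2 * ε) * (t - y) ^ 2 + D * ε / 2 := by
        ring
      linarith
    have h1 := (hy _ (γ y + D * ε / 2) hA').1 fun t ht => by linarith [(abs_le.1 (hq t ht)).2]
    have h2 := (hy _ (γ y - D * ε / 2) hA').2 fun t ht => by linarith [(abs_le.1 (hq t ht)).1]
    rw [abs_le]
    constructor <;> linarith
  have key : |T g y - γ y * e| ≤ D * √m / 2 * (1 + e) + A * m := by
    -- The choice `ε = √m` balances the two terms; for `m = 0` it is unavailable and `ε` tends to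
    -- `0` instead.
    rcases hm.eq_or_lt with h0 | h0
    · rw [← h0, Real.sqrt_zero]
      have hl : Tendsto (fun ε : ℝ => D * ε / 2 * e) (𝓝[>] 0) (𝓝 0) := by
        have : Continuous fun ε : ℝ => D * ε / 2 * e := by fun_prop
        simpa using (this.tendsto 0).mono_left nhdsWithin_le_nhds
      have := ge_of_tendsto (b := |T g y - γ y * e|) hl (by
        filter_upwards [self_mem_nhdsWithin] with ε hε'
        simpa [← h0] using hε ε hε')
      simpa using this
    · have hs : 0 < √m := Real.sqrt_pos.2 h0
      refine (hε _ hs).trans (le_of_eq ?_)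
      have h1 : D / (2 * √m) * m = D * √m / 2 := by
        rw [div_mul_eq_mul_div, div_eq_div_iff (by positivity) (by norm_num)]
        nlinarith [Real.mul_self_sqrt hm]
      rw [add_mul, h1]; ring
  have hs0 := Real.sqrt_nonneg m
  have hs1 : √m ≤ 1 := Real.sqrt_le_one.2 hm1
  have he1 : 1 + e ≤ 2 + |e - 1| := by linarith [le_abs_self (e - 1)]
  have h5 : D * √m / 2 * (1 + e) ≤ D * (2 * √m + |e - 1|) := by
    have h6 : √m / 2 * (1 + e) ≤ 2 * √m + |e - 1| := by
      nlinarith [abs_nonneg (e - 1)]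
    calc _ = D * (√m / 2 * (1 + e)) := by ring
      _ ≤ _ := mul_le_mul_of_nonneg_left h6 hD
  calc |T g y - γ y| = |(T g y - γ y * e) + γ y * (e - 1)| := by ring_nf
    _ ≤ |T g y - γ y * e| + |γ y| * |e - 1| := by
      rw [← abs_mul]; exact abs_add_le _ _
    _ ≤ _ := by linarith

theorem norm_apply_sub_apply_le (hT : IsSublinMonoTrans T) [Fact (1 ≤ p)] {R : ℝ}
    (hR : ∀ f, ‖T f‖ ≤ R * ‖f‖) (f g : LpI p) : ‖T f - T g‖ ≤ R * ‖f - g‖ := by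
  have h1 : ∀ f g : LpI p, T f - T g ≤ T |f - g| := by
    intro f g
    have h2 : f ≤ g + |f - g| := by
      have := le_abs_self (f - g)
      exact sub_le_iff_le_add'.1 this
    exact sub_le_iff_le_add'.2 ((hT.monotone _ _ h2).trans (hT.subadditive _ _))
  have h3 : |T f - T g| ≤ |T (|f - g|)| := by
    refine (abs_le'.2 ⟨h1 f g, ?_⟩).trans (le_abs_self _)
    rw [neg_sub, abs_sub_comm]
    exact h1 g f
  calc ‖T f - T g‖ ≤ ‖T (|f - g|)‖ := norm_le_norm_of_abs_le_abs h3
    _ ≤ R * ‖|f - g|‖ := hR _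
    _ = R * ‖f - g‖ := by rw [norm_abs_eq_norm]

end Operator

/-! ### Contracted Steklov means, their derivatives and integral form. -/

/-- The primitive of `f` that vanishes at `0`. -/
def prim (f : ℝ → ℝ) (x : ℝ) : ℝ := ∫ u in (0 : ℝ)..x, f u

/-- The second forward difference with step `h`. -/
def secDiff (h : ℝ) (f : ℝ → ℝ) (x : ℝ) : ℝ := f (x + 2 * h) - 2 * f (x + h) + f x

/-- The Steklov mean of order two and step `h`, composed with the contraction `x ↦ (1 - 2h) x`, so
that on `[0, 1]` it depends only on the values of `f` on `[0, 1]`. -/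
def steklov (h : ℝ) (f : ℝ → ℝ) (x : ℝ) : ℝ :=
  (h ^ 2)⁻¹ * secDiff h (prim (prim f)) ((1 - 2 * h) * x)

/-- The derivative of `steklov h f`. -/
def steklovD (h : ℝ) (f : ℝ → ℝ) (x : ℝ) : ℝ :=
  (h ^ 2)⁻¹ * (1 - 2 * h) * secDiff h (prim f) ((1 - 2 * h) * x)

/-- The second derivative of `steklov h f`. -/
def steklovDD (h : ℝ) (f : ℝ → ℝ) (x : ℝ) : ℝ :=
  (h ^ 2)⁻¹ * (1 - 2 * h) ^ 2 * secDiff h f ((1 - 2 * h) * x)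

section Calculus

variable {f : ℝ → ℝ} (hf : ∀ a b, IntervalIntegrable f volume a b)
include hf

theorem continuous_prim : Continuous (prim f) := intervalIntegral.continuous_primitive hf 0

theorem prim_sub_prim (a b : ℝ) : prim f b - prim f a = ∫ u in a..b, f u :=
  intervalIntegral.integral_interval_sub_left (hf _ _) (hf _ _)

theorem integral_comp_affine {c : ℝ} (hc : c ≠ 0) (d z : ℝ) :
    ∫ v in (0 : ℝ)..d, f (z + c * v) = c⁻¹ * (prim f (z + c * d) - prim f z) := by
  rw [intervalIntegral.integral_comp_add_mul _ hc, mul_zero, add_zero, prim_sub_prim hf,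
    smul_eq_mul]

theorem hasDerivAt_steklov (h x : ℝ) : HasDerivAt (steklov h f) (steklovD h f x) x := by
  have hF : ∀ y, HasDerivAt (prim (prim f)) (prim f y) y := fun y =>
    (continuous_prim hf).integral_hasStrictDerivAt 0 y |>.hasDerivAt
  have hlin : ∀ b : ℝ, HasDerivAt (fun x => (1 - 2 * h) * x + b) (1 - 2 * h) x := fun b => by
    simpa using ((hasDerivAt_id x).const_mul (1 - 2 * h)).add_const b
  have h1 := (hF ((1 - 2 * h) * x + 2 * h)).comp x (hlin (2 * h))
  have h2 := (hF ((1 - 2 * h) * x + h)).comp x (hlin h)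
  have h3 := (hF ((1 - 2 * h) * x + 0)).comp x (hlin 0)
  have h4 := ((h1.sub (h2.const_mul 2)).add h3).const_mul (h ^ 2)⁻¹
  simp only [add_zero] at h4
  refine HasDerivAt.congr_deriv (f' := _) h4 ?_
  unfold steklovD secDiff
  ring

/-- As `f` is only integrable, the first derivative of the mean is only absolutely continuous; hence
an integral identity rather than a pointwise second derivative. -/
theorem steklovD_sub {h : ℝ} (hh : 1 - 2 * h ≠ 0) (x y : ℝ) :
    steklovD h f y - steklovD h f x = ∫ u in x..y, steklovDD h f u := by
  set a := 1 - 2 * h with ha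
  have hshift : ∀ b : ℝ, ∫ u in x..y, f (a * u + b) =
      a⁻¹ * (prim f (a * y + b) - prim f (a * x + b)) := fun b => by
    rw [intervalIntegral.integral_comp_mul_add _ hh, prim_sub_prim hf, smul_eq_mul]
  have hint : ∀ b : ℝ, IntervalIntegrable (fun u => f (a * u + b)) volume x y := fun b => by
    have h1 := ((hf (a * x + b) (a * y + b)).comp_add_right b).comp_mul_left (c := a)
    simpa [hh] using h1
  have h0 := hint 0
  have h0' := hshift 0
  simp only [add_zero] at h0 h0'
  unfold steklovDD steklovD secDiff
  rw [← ha, intervalIntegral.integral_const_mul, intervalIntegral.integral_add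
    ((hint _).sub ((hint _).const_mul 2)) h0, intervalIntegral.integral_sub (hint _)
    ((hint _).const_mul 2), intervalIntegral.integral_const_mul, hshift, hshift, h0']
  field_simp
  ring

/-- Writing the step as `c * d` puts the means of steps `δ` and `2 * δ` over the same square, so
that their integrands can be combined. -/
theorem steklov_mul_eq {c d : ℝ} (hc : c ≠ 0) (x : ℝ) :
    steklov (c * d) f x = (d ^ 2)⁻¹ * ∫ u in (0 : ℝ)..d, ∫ v in (0 : ℝ)..d,
      f ((1 - 2 * (c * d)) * x + c * u + c * v) := by
  have hF := continuous_prim hf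
  have hF' : ∀ a b, IntervalIntegrable (prim f) volume a b := fun a b => hF.intervalIntegrable a b
  set z := (1 - 2 * (c * d)) * x with hz
  have h1 : ∀ u, ∫ v in (0 : ℝ)..d, f (z + c * u + c * v) =
      c⁻¹ * (prim f ((z + c * d) + c * u) - prim f (z + c * u)) := fun u => by
    rw [integral_comp_affine hf hc]
    congr 3
    ring
  simp_rw [h1]
  rw [intervalIntegral.integral_const_mul, intervalIntegral.integral_sub
    (by apply Continuous.intervalIntegrable; fun_prop)
    (by apply Continuous.intervalIntegrable; fun_prop), integral_comp_affine hF' hc,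
    integral_comp_affine hF' hc]
  unfold steklov secDiff
  rw [← hz, show z + 2 * (c * d) = z + c * d + c * d by ring, mul_pow, mul_inv, pow_two c, mul_inv]
  ring

end Calculus

/-! ### Steklov means measured against second differences. -/

theorem eLpNorm_le_iff_lintegral_le {α : Type*} [MeasurableSpace α] {μ : Measure α} {p : ℝ≥0∞}
    (hp0 : p ≠ 0) (hp : p ≠ ∞) {f : α → ℝ} {c : ℝ≥0∞} :
    eLpNorm f p μ ≤ c ↔ ∫⁻ x, ‖f x‖ₑ ^ p.toReal ∂μ ≤ c ^ p.toReal := by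
  rw [eLpNorm_eq_lintegral_rpow_enorm_toReal hp0 hp, one_div,
    ENNReal.rpow_inv_le_iff (ENNReal.toReal_pos hp0 hp)]

theorem lintegral_rpow_le {α : Type*} [MeasurableSpace α] {ν : Measure α} {r : ℝ} (hr : 1 < r)
    {φ : α → ℝ≥0∞} (hφ : AEMeasurable φ ν) :
    (∫⁻ x, φ x ∂ν) ^ r ≤ ν univ ^ (r - 1) * ∫⁻ x, φ x ^ r ∂ν := by
  have hr0 : 0 < r := by linarith
  have hc := Real.HolderConjugate.conjExponent hr
  have h := ENNReal.lintegral_mul_le_Lp_mul_Lq ν hc hφ (aemeasurable_const (b := (1 : ℝ≥0∞)))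
  simp only [Pi.mul_apply, mul_one, ENNReal.one_rpow, lintegral_const, one_mul] at h
  refine (ENNReal.rpow_le_rpow h hr0.le).trans (le_of_eq ?_)
  rw [ENNReal.mul_rpow_of_nonneg _ _ hr0.le, ← ENNReal.rpow_mul, ← ENNReal.rpow_mul,
    one_div_mul_cancel hr0.ne', ENNReal.rpow_one, mul_comm]
  congr 2
  unfold Real.conjExponent
  field_simp

section Modulus

variable {p : ℝ≥0∞} {f : ℝ → ℝ} {δ : ℝ} {W : ℝ≥0∞}

theorem measurable_secDiff (hfm : Measurable f) (h : ℝ) : Measurable (secDiff h f) := by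
  unfold secDiff
  fun_prop

/-- The substitution `x ↦ (1 - 2h) x` carries `[0, 1]` onto exactly the domain of the second
difference. Its Jacobian is compensated by the factor `(1 - 2h)²` from the chain rule. -/
theorem eLpNorm_steklovDD_le (hp1 : 1 < p) (hp : p < ∞) {h : ℝ}
    (h0 : 0 < h) (h1 : h < 1 / 2)
    (hW : eLpNorm (secDiff h f) p
      (volume.restrict {x : ℝ | x ∈ Icc (0 : ℝ) 1 ∧ x + 2 * h ∈ Icc (0 : ℝ) 1}) ≤ W) :
    eLpNorm (steklovDD h f) p muI ≤ ENNReal.ofReal (h ^ 2)⁻¹ * W := by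
  have hp0 : p ≠ 0 := (zero_lt_one.trans hp1).ne'
  have hr1 : 1 < p.toReal := by
    rw [← ENNReal.toReal_one]
    exact (ENNReal.toReal_lt_toReal ENNReal.one_ne_top hp.ne).2 hp1
  set r := p.toReal
  have hr0 : 0 < r := by linarith
  set a := 1 - 2 * h with ha
  have ha0 : 0 < a := by linarith
  have ha1 : a ≤ 1 := by linarith
  rw [eLpNorm_le_iff_lintegral_le hp0 hp.ne] at hW ⊢
  set Φ : ℝ → ℝ≥0∞ := (Icc 0 a).indicator fun x => ‖secDiff h f x‖ₑ ^ r with hΦ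
  have hset : {x : ℝ | x ∈ Icc (0 : ℝ) 1 ∧ x + 2 * h ∈ Icc (0 : ℝ) 1} = Icc 0 a := by
    ext x
    simp only [mem_ofPred_eq, mem_Icc]
    constructor
    · rintro ⟨⟨h2, h3⟩, h4, h5⟩
      constructor <;> linarith
    · rintro ⟨h2, h3⟩
      refine ⟨⟨?_, ?_⟩, ?_, ?_⟩ <;> linarith
  rw [hset, ← lintegral_indicator measurableSet_Icc] at hW
  have hscale : ∫⁻ x, Φ (a * x) = ENNReal.ofReal a⁻¹ * ∫⁻ x, Φ x := by
    have h2 := (Homeomorph.mulLeft₀ a ha0.ne').measurableEmbedding.lintegral_map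
      (μ := volume) Φ
    rw [show ⇑(Homeomorph.mulLeft₀ a ha0.ne') = (a * ·) from rfl,
      Real.map_volume_mul_left ha0.ne', lintegral_smul_measure,
      abs_of_pos (inv_pos.2 ha0), smul_eq_mul] at h2
    exact h2.symm
  calc ∫⁻ x in Icc (0 : ℝ) 1, ‖steklovDD h f x‖ₑ ^ r
      ≤ ∫⁻ x, ENNReal.ofReal ((h ^ 2)⁻¹ * a ^ 2) ^ r * Φ (a * x) := by
        rw [← lintegral_indicator measurableSet_Icc]
        refine lintegral_mono fun x => ?_
        by_cases hx : x ∈ Icc (0 : ℝ) 1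
        · have hax : a * x ∈ Icc 0 a :=
            ⟨mul_nonneg ha0.le hx.1, mul_le_of_le_one_right ha0.le hx.2⟩
          rw [indicator_of_mem hx, hΦ, indicator_of_mem hax, steklovDD, enorm_mul,
            ENNReal.mul_rpow_of_nonneg _ _ hr0.le, Real.enorm_eq_ofReal (by positivity)]
        · rw [indicator_of_notMem hx]
          exact zero_le
    _ = ENNReal.ofReal ((h ^ 2)⁻¹ * a ^ 2) ^ r * ENNReal.ofReal a⁻¹ * ∫⁻ x, Φ x := by
        rw [lintegral_const_mul' _ _ (ENNReal.rpow_ne_top_of_nonneg hr0.le ENNReal.ofReal_ne_top),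
          hscale, mul_assoc]
    _ ≤ ENNReal.ofReal (h ^ 2)⁻¹ ^ r * W ^ r := by
        gcongr
        rw [ENNReal.ofReal_rpow_of_nonneg (by positivity) hr0.le,
          ENNReal.ofReal_rpow_of_nonneg (by positivity) hr0.le,
          ← ENNReal.ofReal_mul (by positivity)]
        refine ENNReal.ofReal_le_ofReal ?_
        rw [Real.mul_rpow (by positivity) (by positivity), mul_assoc]
        refine mul_le_of_le_one_right (by positivity) ?_
        rw [← div_eq_mul_inv, div_le_one ha0]
        calc (a ^ 2) ^ r ≤ (a ^ 2) ^ (1 : ℝ) :=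
              Real.rpow_le_rpow_of_exponent_ge (by positivity) (by nlinarith) hr1.le
          _ ≤ a := by rw [Real.rpow_one]; nlinarith
    _ = _ := by rw [ENNReal.mul_rpow_of_nonneg _ _ hr0.le]

theorem enorm_steklov_sub_le (hfi : ∀ a b, IntervalIntegrable f volume a b)
    (h0 : 0 < δ) (hδ : δ ≤ 1 / 8) {x : ℝ} (hx : x ∈ Icc (0 : ℝ) 1) :
    ‖f x - (2 * steklov δ f x - steklov (2 * δ) f x)‖ₑ ≤ ENNReal.ofReal δ⁻¹ *
      ∫⁻ w in Icc (-(2 * δ)) (2 * δ),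
        {z : ℝ × ℝ | z.1 + 2 * z.2 ∈ Icc (0 : ℝ) 1}.indicator
          (fun z => ‖secDiff z.2 f z.1‖ₑ) (x, w) := by
  set K : ℝ → ℝ≥0∞ := fun w => {z : ℝ × ℝ | z.1 + 2 * z.2 ∈ Icc (0 : ℝ) 1}.indicator
          (fun z => ‖secDiff z.2 f z.1‖ₑ) (x, w) with hK
  have hFc := continuous_prim hfi
  have e1 := steklov_mul_eq hfi (c := 1) (d := δ) one_ne_zero x
  have e2 := steklov_mul_eq hfi (c := 2) (d := δ) two_ne_zero x
  simp only [one_mul] at e1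
  have hin : ∀ c : ℝ, c ≠ 0 → ∀ z, IntervalIntegrable (fun v => f (z + c * v)) volume 0 δ := by
    intro c hc z
    have h1 := ((hfi (z + c * 0) (z + c * δ)).comp_add_left z).comp_mul_left (c := c)
    simpa [hc] using h1
  have hout : ∀ c : ℝ, c ≠ 0 → ∀ z, IntervalIntegrable
      (fun u => ∫ v in (0 : ℝ)..δ, f (z + c * u + c * v)) volume 0 δ := by
    intro c hc z
    refine Continuous.intervalIntegrable ?_ _ _
    simp_rw [integral_comp_affine hfi hc]
    fun_prop
  -- With `w = u + v - 2δx`, the points sampled by the means of steps `δ` and `2δ` are `x + w` and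
  -- `x + 2w`: the combination is chosen so that its error is an average of second differences based
  -- at `x`.
  have hrep : f x - (2 * steklov δ f x - steklov (2 * δ) f x) =
      (δ ^ 2)⁻¹ * ∫ u in (0 : ℝ)..δ, ∫ v in (0 : ℝ)..δ, secDiff (v + (u - 2 * δ * x)) f x := by
    have hs : ∀ u v, secDiff (v + (u - 2 * δ * x)) f x =
        f ((1 - 2 * (2 * δ)) * x + 2 * u + 2 * v) - 2 * f ((1 - 2 * δ) * x + u + v) + f x := by
      intro u v
      unfold secDiff
      congr 2
      · congr 1; ring
      · congr 2; ring
    have hin1 := hin 1 one_ne_zero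
    have hout1 := hout 1 one_ne_zero ((1 - 2 * δ) * x)
    simp only [one_mul] at hin1 hout1
    simp_rw [hs]
    have hinner : ∀ u, (∫ v in (0 : ℝ)..δ, (f ((1 - 2 * (2 * δ)) * x + 2 * u + 2 * v) -
        2 * f ((1 - 2 * δ) * x + u + v) + f x)) =
        (∫ v in (0 : ℝ)..δ, f ((1 - 2 * (2 * δ)) * x + 2 * u + 2 * v)) -
          2 * (∫ v in (0 : ℝ)..δ, f ((1 - 2 * δ) * x + u + v)) + δ * f x := by
      intro u
      rw [intervalIntegral.integral_add ((hin 2 two_ne_zero _).sub ((hin1 _).const_mul 2))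
        intervalIntegrable_const, intervalIntegral.integral_sub (hin 2 two_ne_zero _)
        ((hin1 _).const_mul 2), intervalIntegral.integral_const_mul,
        intervalIntegral.integral_const, sub_zero, smul_eq_mul]
    simp_rw [hinner]
    rw [intervalIntegral.integral_add ((hout 2 two_ne_zero _).sub (hout1.const_mul 2))
        intervalIntegrable_const, intervalIntegral.integral_sub (hout 2 two_ne_zero _)
        (hout1.const_mul 2), intervalIntegral.integral_const_mul,
        intervalIntegral.integral_const, sub_zero, smul_eq_mul, e1, e2]
    field_simp
    ring
  have hin2 : ∀ u ∈ Ioc 0 δ, ∫⁻ v in Ioc 0 δ, ‖secDiff (v + (u - 2 * δ * x)) f x‖ₑ ≤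
      ∫⁻ w in Icc (-(2 * δ)) (2 * δ), K w := by
    intro u hu
    -- Translate `v` to `w = v + (u - 2δx)`. Then `|w| ≤ 2δ`, and the contraction keeps `x + 2w = (1
    -- - 4δ) x + 2u + 2v` inside `[0, 1]`.
    rw [← lintegral_indicator measurableSet_Ioc, ← lintegral_indicator measurableSet_Icc,
      ← lintegral_add_right_eq_self ((Icc (-(2 * δ)) (2 * δ)).indicator K) (u - 2 * δ * x)]
    refine lintegral_mono fun v => ?_
    by_cases hv : v ∈ Ioc 0 δ
    · have h3 : 0 ≤ δ * x := mul_nonneg h0.le hx.1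
      have h4 : δ * x ≤ δ := mul_le_of_le_one_right h0.le hx.2
      have hw : v + (u - 2 * δ * x) ∈ Icc (-(2 * δ)) (2 * δ) := by
        constructor <;> linarith [hu.1, hu.2, hv.1, hv.2]
      have hz : x + 2 * (v + (u - 2 * δ * x)) ∈ Icc (0 : ℝ) 1 := by
        constructor <;> nlinarith [hu.1, hu.2, hv.1, hv.2, hx.1, hx.2]
      rw [indicator_of_mem hv, indicator_of_mem hw, hK]
      simp only
      rw [indicator_of_mem (by exact hz)]
    · rw [indicator_of_notMem hv]
      exact zero_le
  rw [hrep, enorm_mul, Real.enorm_eq_ofReal (by positivity),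
    intervalIntegral.integral_of_le h0.le]
  calc _ ≤ ENNReal.ofReal (δ ^ 2)⁻¹ *
        ∫⁻ u in Ioc 0 δ, ∫⁻ w in Icc (-(2 * δ)) (2 * δ), K w := by
        refine mul_le_mul_right ?_ _
        refine (enorm_integral_le_lintegral_enorm _).trans
          (setLIntegral_mono' measurableSet_Ioc fun u hu => ?_)
        rw [intervalIntegral.integral_of_le h0.le]
        exact (enorm_integral_le_lintegral_enorm _).trans (hin2 u hu)
    _ = _ := by
        rw [setLIntegral_const, Real.volume_Ioc, sub_zero, mul_comm (lintegral _ _), ← mul_assoc,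
          ← ENNReal.ofReal_mul (by positivity)]
        congr 2
        field_simp

/-- Jensen in `w` and Tonelli reduce to the norm of a single second difference; the 4 is `δ⁻¹` times
the length `4δ` of the range of `w`. -/
theorem eLpNorm_sub_steklov_le (hp1 : 1 < p) (hp : p < ∞) (hfm : Measurable f)
    (hfi : ∀ a b, IntervalIntegrable f volume a b) (h0 : 0 < δ) (hδ : δ ≤ 1 / 8)
    (hW : ∀ h : ℝ, |h| ≤ 2 * δ → eLpNorm (secDiff h f) p
      (volume.restrict {x : ℝ | x ∈ Icc (0 : ℝ) 1 ∧ x + 2 * h ∈ Icc (0 : ℝ) 1}) ≤ W) :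
    eLpNorm (fun x => f x - (2 * steklov δ f x - steklov (2 * δ) f x)) p muI ≤ 4 * W := by
  have hp0 : p ≠ 0 := (zero_lt_one.trans hp1).ne'
  have hr1 : 1 < p.toReal := by
    rw [← ENNReal.toReal_one]
    exact (ENNReal.toReal_lt_toReal ENNReal.one_ne_top hp.ne).2 hp1
  simp_rw [eLpNorm_le_iff_lintegral_le hp0 hp.ne] at hW ⊢
  set r := p.toReal
  have hr0 : 0 < r := by linarith
  have hS : MeasurableSet {z : ℝ × ℝ | z.1 + 2 * z.2 ∈ Icc (0 : ℝ) 1} :=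
    measurableSet_Icc.preimage (f := fun z : ℝ × ℝ => z.1 + 2 * z.2) (by fun_prop)
  have hKm : Measurable ({z : ℝ × ℝ | z.1 + 2 * z.2 ∈ Icc (0 : ℝ) 1}.indicator
      (fun z => ‖secDiff z.2 f z.1‖ₑ)) := by
    refine Measurable.indicator ?_ hS
    unfold secDiff
    fun_prop
  set K : ℝ × ℝ → ℝ≥0∞ := {z : ℝ × ℝ | z.1 + 2 * z.2 ∈ Icc (0 : ℝ) 1}.indicator
      (fun z => ‖secDiff z.2 f z.1‖ₑ) with hK
  have hinner : ∀ w ∈ Icc (-(2 * δ)) (2 * δ), ∫⁻ x in Icc (0 : ℝ) 1, K (x, w) ^ r ≤ W ^ r := by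
    intro w hw
    refine le_trans (le_of_eq ?_) (hW w (abs_le.2 hw))
    have hSw : MeasurableSet {x : ℝ | x + 2 * w ∈ Icc (0 : ℝ) 1} :=
      measurableSet_Icc.preimage (f := fun x : ℝ => x + 2 * w) (by fun_prop)
    rw [show {x : ℝ | x ∈ Icc (0 : ℝ) 1 ∧ x + 2 * w ∈ Icc (0 : ℝ) 1} =
        {x : ℝ | x + 2 * w ∈ Icc (0 : ℝ) 1} ∩ Icc 0 1 by ext x; simp [and_comm],
      ← Measure.restrict_restrict hSw, ← lintegral_indicator hSw]
    refine lintegral_congr fun x => ?_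
    by_cases hx : x + 2 * w ∈ Icc (0 : ℝ) 1
    · rw [hK, indicator_of_mem (by exact hx), indicator_of_mem (by exact hx)]
    · rw [hK, indicator_of_notMem (by exact hx), indicator_of_notMem (by exact hx),
        ENNReal.zero_rpow_of_pos hr0]
  have hvol : volume (Icc (-(2 * δ)) (2 * δ)) = ENNReal.ofReal (4 * δ) := by
    rw [Real.volume_Icc]; congr 1; ring
  have hδ4 : ENNReal.ofReal (4 * δ) ≠ 0 := by simpa using h0
  calc ∫⁻ x in Icc (0 : ℝ) 1, ‖f x - (2 * steklov δ f x - steklov (2 * δ) f x)‖ₑ ^ r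
      ≤ ∫⁻ x in Icc (0 : ℝ) 1, ENNReal.ofReal δ⁻¹ ^ r * (ENNReal.ofReal (4 * δ) ^ (r - 1) *
          ∫⁻ w in Icc (-(2 * δ)) (2 * δ), K (x, w) ^ r) := by
        refine setLIntegral_mono' measurableSet_Icc fun x hx => ?_
        refine (ENNReal.rpow_le_rpow (enorm_steklov_sub_le hfi h0 hδ hx) hr0.le).trans ?_
        rw [ENNReal.mul_rpow_of_nonneg _ _ hr0.le]
        refine mul_le_mul_right ?_ _
        have := lintegral_rpow_le (ν := volume.restrict (Icc (-(2 * δ)) (2 * δ))) hr1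
          (φ := fun w => K (x, w)) (hKm.comp (by fun_prop)).aemeasurable
        rwa [Measure.restrict_apply_univ, hvol] at this
    _ = ENNReal.ofReal δ⁻¹ ^ r * (ENNReal.ofReal (4 * δ) ^ (r - 1) *
          ∫⁻ w in Icc (-(2 * δ)) (2 * δ), ∫⁻ x in Icc (0 : ℝ) 1, K (x, w) ^ r) := by
        rw [lintegral_const_mul' _ _ (ENNReal.rpow_ne_top_of_nonneg hr0.le ENNReal.ofReal_ne_top),
          lintegral_const_mul' _ _ (ENNReal.rpow_ne_top_of_nonneg (by linarith)
            ENNReal.ofReal_ne_top), lintegral_lintegral_swap]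
        exact (hKm.pow_const r).aemeasurable
    _ ≤ ENNReal.ofReal δ⁻¹ ^ r * (ENNReal.ofReal (4 * δ) ^ (r - 1) *
          ∫⁻ w in Icc (-(2 * δ)) (2 * δ), W ^ r) := by
        refine mul_le_mul_right (mul_le_mul_right ?_ _) _
        exact setLIntegral_mono' measurableSet_Icc hinner
    _ = (4 * W) ^ r := by
        rw [setLIntegral_const, hvol, mul_comm (W ^ r), ← mul_assoc, ← mul_assoc, mul_assoc
          (ENNReal.ofReal δ⁻¹ ^ r)]
        have hone := ENNReal.rpow_one (ENNReal.ofReal (4 * δ))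
        nth_rewrite 2 [← hone]
        rw [← ENNReal.rpow_add _ _ hδ4 ENNReal.ofReal_ne_top, sub_add_cancel,
          ← ENNReal.mul_rpow_of_nonneg _ _ hr0.le, ← ENNReal.ofReal_mul (by positivity),
          show δ⁻¹ * (4 * δ) = 4 by field_simp, ← ENNReal.mul_rpow_of_nonneg _ _ hr0.le]
        norm_num

end Modulus

/-! ### Taylor expansion with integrable second derivative. -/

instance isProbabilityMeasure_muI : IsProbabilityMeasure muI :=
  ⟨by simp⟩

section Taylor

variable {γ D q : ℝ → ℝ} (hγ : ∀ x, HasDerivAt γ (D x) x)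
  (hD : ∀ x y, D y - D x = ∫ u in x..y, q u) (hq : Integrable q)
include hγ hD hq

/-- The mean value inequality for `x ↦ γ x - D y * x`, whose derivative `D x - D y` is an integral
of `q` between `y` and `x`. -/
theorem abs_taylor_remainder_le (y t : ℝ) :
    |γ t - γ y - D y * (t - y)| ≤ (∫ u in uIcc y t, |q u|) * |t - y| := by
  have hbd : ∀ x ∈ uIcc y t, ‖D x - D y‖ ≤ ∫ u in uIcc y t, |q u| := by
    intro x hx
    rw [hD]
    refine (intervalIntegral.norm_integral_le_integral_norm_uIoc).trans ?_
    refine setIntegral_mono_set hq.norm.integrableOn (Eventually.of_forall fun _ => norm_nonneg _)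
      (LE.le.eventuallyLE ?_)
    exact uIoc_subset_uIcc.trans (uIcc_subset_uIcc left_mem_uIcc hx)
  have h := (convex_uIcc y t).norm_image_sub_le_of_norm_hasDerivWithin_le
    (f := fun x => γ x - D y * x) (f' := fun x => D x - D y)
    (fun x _ => ((hγ x).sub (by simpa using (hasDerivAt_id x).const_mul (D y))).hasDerivWithinAt)
    hbd left_mem_uIcc right_mem_uIcc
  rw [Real.norm_eq_abs, Real.norm_eq_abs] at h
  refine le_trans (le_of_eq ?_) h
  congr 1
  ring

/-- The segment from `y` to `t` lies in the ball of radius `|t - y|` about `y`, of length `2 |t -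
y|`; this is the factor 2. -/
theorem abs_taylor_remainder_le_maximalFn {y t : ℝ} (hy : y ∈ Icc (0 : ℝ) 1)
    (ht : t ∈ Icc (0 : ℝ) 1)
    (hfin : maximalFn (fun x => ‖(Icc (0 : ℝ) 1).indicator q x‖ₑ) y ≠ ∞) :
    |γ t - γ y - D y * (t - y)| ≤
      2 * (maximalFn (fun x => ‖(Icc (0 : ℝ) 1).indicator q x‖ₑ) y).toReal * (t - y) ^ 2 := by
  set M := maximalFn (fun x => ‖(Icc (0 : ℝ) 1).indicator q x‖ₑ) y
  have h1 : ENNReal.ofReal (∫ u in uIcc y t, |q u|) ≤ ENNReal.ofReal (2 * |t - y|) * M := by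
    refine le_trans ?_ (lintegral_closedBall_le_maximalFn _ y (abs_nonneg _))
    have h2 : uIcc y t ⊆ Metric.closedBall y |t - y| := fun x hx =>
      abs_sub_left_of_mem_uIcc hx
    change ENNReal.ofReal (∫ u in uIcc y t, ‖q u‖) ≤ _
    rw [ofReal_integral_norm_eq_lintegral_enorm hq.integrableOn]
    refine le_trans (le_of_eq ?_) (lintegral_mono_set h2)
    refine setLIntegral_congr_fun measurableSet_uIcc fun x hx => ?_
    rw [indicator_of_mem (uIcc_subset_Icc hy ht hx)]
  have h3 : ∫ u in uIcc y t, |q u| ≤ 2 * |t - y| * M.toReal := by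
    have h4 := ENNReal.toReal_mono (ENNReal.mul_ne_top ENNReal.ofReal_ne_top hfin) h1
    rwa [ENNReal.toReal_mul, ENNReal.toReal_ofReal (by positivity),
      ENNReal.toReal_ofReal (by positivity)] at h4
  refine (abs_taylor_remainder_le hγ hD hq y t).trans ?_
  rw [← sq_abs (t - y)]
  nlinarith [abs_nonneg (t - y)]

/-- The tangent line of `γ` at `y` differs from `γ` by at most the `L₁` norm of `q` on `[0, 1]`, and
the coefficients of a line are recovered by integrating it against fixed weights. -/
theorem abs_deriv_le {y : ℝ} (hy : y ∈ Icc (0 : ℝ) 1) :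
    |D y| ≤ 6 * ((∫ t in Icc (0 : ℝ) 1, |γ t|) + ∫ t in Icc (0 : ℝ) 1, |q t|) ∧
    |γ y| ≤ 4 * ((∫ t in Icc (0 : ℝ) 1, |γ t|) + ∫ t in Icc (0 : ℝ) 1, |q t|) := by
  set Ng := ∫ t in Icc (0 : ℝ) 1, |γ t| with hNg
  set Nq := ∫ t in Icc (0 : ℝ) 1, |q t|
  have hγc : Continuous γ := continuous_iff_continuousAt.2 fun x => (hγ x).continuousAt
  have hNg' : Ng = ∫ t in (0 : ℝ)..1, |γ t| := by
    rw [intervalIntegral.integral_of_le zero_le_one, hNg, integral_Icc_eq_integral_Ioc]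
  set ρ : ℝ → ℝ := fun t => γ t - γ y - D y * (t - y) with hρ
  have hρc : Continuous ρ := by fun_prop
  have hNq0 : 0 ≤ Nq := integral_nonneg fun _ => abs_nonneg _
  have hρbd : ∀ t ∈ Icc (0 : ℝ) 1, |ρ t| ≤ Nq := by
    intro t ht
    refine (abs_taylor_remainder_le hγ hD hq y t).trans ?_
    have h1 : ∫ u in uIcc y t, |q u| ≤ Nq :=
      setIntegral_mono_set hq.abs.integrableOn (Eventually.of_forall fun _ => abs_nonneg _)
        (LE.le.eventuallyLE (uIcc_subset_Icc hy ht))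
    have h2 : |t - y| ≤ 1 := by
      rw [abs_le]; constructor <;> linarith [ht.1, ht.2, hy.1, hy.2]
    have h3 : 0 ≤ ∫ u in uIcc y t, |q u| := integral_nonneg fun _ => abs_nonneg _
    nlinarith [abs_nonneg (t - y)]
  have hweight : ∀ (w : ℝ → ℝ) (B : ℝ), Continuous w → 0 ≤ B → (∀ t ∈ Icc (0 : ℝ) 1, |w t| ≤ B) →
      |∫ t in (0 : ℝ)..1, w t * (γ t - ρ t)| ≤ B * (Ng + Nq) := by
    intro w B hw hB hwB
    have h1 : ∀ t ∈ Icc (0 : ℝ) 1, |w t * (γ t - ρ t)| ≤ B * (|γ t| + Nq) := by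
      intro t ht
      rw [abs_mul]
      refine mul_le_mul (hwB t ht) ?_ (abs_nonneg _) hB
      exact (abs_sub _ _).trans (by linarith [hρbd t ht])
    calc _ ≤ ∫ t in (0 : ℝ)..1, |w t * (γ t - ρ t)| :=
          intervalIntegral.abs_integral_le_integral_abs zero_le_one
      _ ≤ ∫ t in (0 : ℝ)..1, B * (|γ t| + Nq) :=
          intervalIntegral.integral_mono_on zero_le_one
            (by apply Continuous.intervalIntegrable; fun_prop)
            (by apply Continuous.intervalIntegrable; fun_prop) h1
      _ = _ := by
          rw [intervalIntegral.integral_const_mul, intervalIntegral.integral_add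
            (by apply Continuous.intervalIntegrable; fun_prop) intervalIntegrable_const, ← hNg']
          simp
  have hdiff : ∀ t, γ t - ρ t = (γ y - D y * y) + D y * t := fun t => by rw [hρ]; ring
  have hDy : |D y| ≤ 6 * (Ng + Nq) := by
    -- This weight is orthogonal to constants and has integral 1 against `t`, so it extracts the
    -- slope `D y`.
    have h1 := hweight (fun t => 12 * t - 6) 6 (by fun_prop) (by norm_num) fun t ht => by
      rw [abs_le]; constructor <;> linarith [ht.1, ht.2]
    convert h1 using 2
    simp_rw [hdiff]
    have h2 : ∀ t : ℝ, (12 * t - 6) * (γ y - D y * y + D y * t) =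
        (-6 * (γ y - D y * y)) + (12 * (γ y - D y * y) - 6 * D y) * t + 12 * D y * t ^ 2 :=
      fun t => by ring
    simp_rw [h2]
    rw [intervalIntegral.integral_add (by apply Continuous.intervalIntegrable; fun_prop)
      (by apply Continuous.intervalIntegrable; fun_prop), intervalIntegral.integral_add
      (by apply Continuous.intervalIntegrable; fun_prop)
      (by apply Continuous.intervalIntegrable; fun_prop), intervalIntegral.integral_const_mul,
      intervalIntegral.integral_const_mul, intervalIntegral.integral_const_mul, intervalIntegral.integral_const,
      integral_id, integral_pow]
    simp only [smul_eq_mul]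
    norm_num
    ring
  refine ⟨hDy, ?_⟩
  -- The weight 1 gives the tangent line at `1 / 2`; returning to `y` costs half the slope bound,
  -- whence `4 = 1 + 3`.
  have h1 := hweight (fun _ => 1) 1 (by fun_prop) (by norm_num) fun t ht => by simp
  have h2 : ∫ t in (0 : ℝ)..1, (1 : ℝ) * (γ t - ρ t) = γ y + D y * (1 / 2 - y) := by
    simp_rw [hdiff, one_mul]
    rw [intervalIntegral.integral_add (by apply Continuous.intervalIntegrable; fun_prop)
      (by apply Continuous.intervalIntegrable; fun_prop), intervalIntegral.integral_const_mul,
      integral_id]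
    simp
    ring
  rw [h2] at h1
  have h3 : |D y * (1 / 2 - y)| ≤ 6 * (Ng + Nq) * (1 / 2) := by
    rw [abs_mul]
    refine mul_le_mul hDy ?_ (abs_nonneg _) ((abs_nonneg _).trans hDy)
    rw [abs_le]; constructor <;> linarith [hy.1, hy.2]
  have h4 : |γ y| ≤ |γ y + D y * (1 / 2 - y)| + |D y * (1 / 2 - y)| := by
    have := abs_sub (γ y + D y * (1 / 2 - y)) (D y * (1 / 2 - y))
    rwa [add_sub_cancel_right] at this
  linarith

end Taylor

/-! ### The error for smooth functions. -/

theorem aemeasurable_secondMoment {p : ℝ≥0∞} {T : LpI p → LpI p} (hT : IsSublinMonoTrans T) :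
    AEMeasurable (secondMoment T) muI := by
  refine aemeasurable_of_tendsto_metrizable_ae atTop
    (f := fun m y => T (sqShift p (dyadic m y)) y) (fun m => ?_) (ae_tendsto_secondMoment hT)
  -- The dyadic parameter depends on `y` only through an integer, so joint measurability over `ℤ ×
  -- ℝ` suffices.
  have h1 : Measurable fun z : ℤ × ℝ => T (sqShift p ((z.1 : ℝ) / 2 ^ m)) z.2 :=
    measurable_from_prod_countable_right fun k : ℤ => (Lp.stronglyMeasurable (T (sqShift p ((k : ℝ) / 2 ^ m)))).measurable
  exact (h1.comp ((Int.measurable_floor.comp (measurable_const_mul ((2 : ℝ) ^ m))).prodMk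
    measurable_id)).aemeasurable

theorem eLpNorm_maximalFn_le {p : ℝ≥0∞} (hp1 : 1 < p) (hp : p < ∞) :
    ∃ C : ℝ, 0 ≤ C ∧ ∀ q : ℝ → ℝ, Measurable q → Integrable q →
      eLpNorm (fun y => (maximalFn (fun x => ‖(Icc (0 : ℝ) 1).indicator q x‖ₑ) y).toReal) p muI ≤
        ENNReal.ofReal C * eLpNorm q p muI := by
  have hp0 : p ≠ 0 := (zero_lt_one.trans hp1).ne'
  have hr1 : 1 < p.toReal := by
    rw [← ENNReal.toReal_one]
    exact (ENNReal.toReal_lt_toReal ENNReal.one_ne_top hp.ne).2 hp1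
  set r := p.toReal with hr
  have hr0 : 0 < r := by linarith
  have hc0 : 0 ≤ r * (8 * 2 ^ (r - 1) / (r - 1)) :=
    mul_nonneg hr0.le (div_nonneg (by positivity) (by linarith))
  refine ⟨(r * (8 * 2 ^ (r - 1) / (r - 1))) ^ r⁻¹, Real.rpow_nonneg hc0 _, fun q hq hqi => ?_⟩
  rw [eLpNorm_le_iff_lintegral_le hp0 hp.ne, ENNReal.mul_rpow_of_nonneg _ _ hr0.le,
    ← hr, ENNReal.ofReal_rpow_of_nonneg (Real.rpow_nonneg hc0 _) hr0.le,
    Real.rpow_inv_rpow hc0 hr0.ne']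
  have h1 := maximalFn_strong_type (hq.indicator measurableSet_Icc)
    (hqi.indicator (measurableSet_Icc (a := (0 : ℝ)) (b := 1))) hr1
  refine le_trans ?_ (h1.trans (le_of_eq ?_))
  · refine (setLIntegral_le_lintegral _ _).trans (lintegral_mono fun y => ?_)
    gcongr
    rw [Real.enorm_eq_ofReal ENNReal.toReal_nonneg]
    exact ENNReal.ofReal_toReal_le
  · congr 1
    rw [eLpNorm_eq_lintegral_rpow_enorm_toReal hp0 hp.ne, ← hr, one_div,
      ENNReal.rpow_inv_rpow hr0.ne', ← lintegral_indicator measurableSet_Icc]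
    refine lintegral_congr fun x => ?_
    by_cases hx : x ∈ Icc (0 : ℝ) 1
    · simp only [indicator_of_mem hx]
    · simp only [indicator_of_notMem hx, enorm_zero, ENNReal.zero_rpow_of_pos hr0]

theorem ofReal_integral_abs_le {p : ℝ≥0∞} (hp1 : 1 ≤ p) {φ : ℝ → ℝ}
    (hφ : IntegrableOn φ (Icc 0 1)) :
    ENNReal.ofReal (∫ t in Icc (0 : ℝ) 1, |φ t|) ≤ eLpNorm φ p muI := by
  change ENNReal.ofReal (∫ t in Icc (0 : ℝ) 1, ‖φ t‖) ≤ _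
  rw [ofReal_integral_norm_eq_lintegral_enorm hφ, ← eLpNorm_one_eq_lintegral_enorm]
  exact eLpNorm_le_eLpNorm_of_exponent_le hp1 hφ.aestronglyMeasurable

/-- The error of approximation of a function `γ` whose second derivative is `q`. -/
theorem eLpNorm_apply_sub_le {p : ℝ≥0∞} (hp1 : 1 < p) (hp : p < ∞) :
    ∃ C : ℝ, 0 ≤ C ∧ ∀ (T : LpI p → LpI p) (_ : IsSublinMonoTrans T) (σ : ℝ≥0∞), σ ≤ 1 →
      eLpNorm (T (e0 p) - e0 p : LpI p) p muI ≤ σ →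
      eLpNorm (fun x => √(secondMoment T x)) p muI ≤ σ → muT T ≤ σ →
      ∀ γ D q : ℝ → ℝ, (∀ x, HasDerivAt γ (D x) x) → (∀ x y, D y - D x = ∫ u in x..y, q u) →
        Measurable q → Integrable q → ∀ g : LpI p, g =ᵐ[muI] γ →
          eLpNorm (T g - g : LpI p) p muI ≤
            ENNReal.ofReal C * (σ * (eLpNorm γ p muI + eLpNorm q p muI)) := by
  obtain ⟨C, hC0, hC⟩ := eLpNorm_maximalFn_le hp1 hp
  -- From `|γ| ≤ 4N` and `|D| ≤ 6N`: the `|T e₀ - 1|` terms give `4 + 6`, the `√m` term gives `6 *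
  -- 2`, and the Taylor remainder gives `2 * C`.
  refine ⟨22 + 2 * C, by positivity,
    fun T hT σ hσ1 hE hm hμ γ D q hγ hD hqm hq g hg => ?_⟩
  have hγc : Continuous γ := continuous_iff_continuousAt.2 fun x => (hγ x).continuousAt
  have hσ : σ ≠ ∞ := (hσ1.trans_lt ENNReal.one_lt_top).ne
  set N := (∫ t in Icc (0 : ℝ) 1, |γ t|) + ∫ t in Icc (0 : ℝ) 1, |q t| with hN
  have hN0 : 0 ≤ N := add_nonneg (integral_nonneg fun _ => abs_nonneg _)
    (integral_nonneg fun _ => abs_nonneg _)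
  have hNle : ENNReal.ofReal N ≤ eLpNorm γ p muI + eLpNorm q p muI := by
    rw [hN, ENNReal.ofReal_add (integral_nonneg fun _ => abs_nonneg _)
      (integral_nonneg fun _ => abs_nonneg _)]
    exact add_le_add (ofReal_integral_abs_le hp1.le (hγc.integrableOn_Icc))
      (ofReal_integral_abs_le hp1.le hq.integrableOn)
  set M : ℝ → ℝ := fun y =>
    (maximalFn (fun x => ‖(Icc (0 : ℝ) 1).indicator q x‖ₑ) y).toReal with hM
  have hMm : Measurable M :=
    (measurable_maximalFn (hqm.indicator measurableSet_Icc).enorm).ennreal_toReal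
  have hMfin : ∀ᵐ y ∂muI, maximalFn (fun x => ‖(Icc (0 : ℝ) 1).indicator q x‖ₑ) y < ∞ :=
    ae_restrict_of_ae (maximalFn_ae_lt_top
      (hq.indicator (measurableSet_Icc (a := (0 : ℝ)) (b := 1))).2.ne)
  have hmσ : ∀ᵐ y ∂muI, secondMoment T y ≤ σ.toReal := by
    have h1 : ∀ᵐ y ∂muI, ‖secondMoment T y‖ₑ ≤ muT T := by
      rw [muT, eLpNorm_exponent_top]
      exact enorm_ae_le_eLpNormEssSup _ _
    filter_upwards [h1] with y hy
    have h2 := ENNReal.toReal_mono hσ (hy.trans hμ)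
    rw [toReal_enorm] at h2
    exact (le_abs_self _).trans h2
  have hσr : σ.toReal ≤ 1 := by
    simpa using ENNReal.toReal_mono ENNReal.one_ne_top hσ1
  set E : LpI p := T (e0 p) - e0 p
  have hpt : ∀ᵐ y ∂muI, ‖(T g - g : LpI p) y‖ ≤
      (((10 * N) • fun y => ‖E y‖) + ((2 * σ.toReal) • M) +
        ((12 * N) • fun y => √(secondMoment T y))) y := by
    filter_upwards [ae_abs_apply_sub_le hT hg, hmσ, hMfin, secondMoment_nonneg hT, hg,
      Lp.coeFn_sub (T g) g, Lp.coeFn_sub (T (e0 p)) (e0 p), coeFn_e0 p,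
      ae_restrict_mem measurableSet_Icc] with y h1 h2 h3 h4 h5 h6 h7 h8 hy
    obtain ⟨hDy, hγy⟩ := abs_deriv_le hγ hD hq hy
    have hM0 : 0 ≤ M y := ENNReal.toReal_nonneg
    have h9 := h1 (h2.trans hσr) (2 * M y) |D y| (by positivity) (abs_nonneg _) fun t ht => by
      have h10 := abs_taylor_remainder_le_maximalFn hγ hD hq hy ht h3.ne
      have h11 := abs_add_le (γ t - γ y - D y * (t - y)) (D y * (t - y))
      rw [sub_add_cancel, abs_mul] at h11
      linarith
    have hEy : ‖E y‖ = |T (e0 p) y - 1| := by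
      rw [Real.norm_eq_abs, h7, Pi.sub_apply, h8]
    simp only [Pi.add_apply, Pi.smul_apply, smul_eq_mul]
    rw [h6, Pi.sub_apply, h5, hEy, Real.norm_eq_abs]
    have h12 := mul_le_mul_of_nonneg_right hγy (abs_nonneg (T (e0 p) y - 1))
    have h13 := mul_le_mul_of_nonneg_right hDy
      (add_nonneg (mul_nonneg zero_le_two (Real.sqrt_nonneg (secondMoment T y)))
        (abs_nonneg (T (e0 p) y - 1)))
    have h14 := mul_le_mul_of_nonneg_left h2 (mul_nonneg zero_le_two hM0)
    linarith
  have hsm : AEStronglyMeasurable (fun y => √(secondMoment T y)) muI :=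
    (Real.continuous_sqrt.measurable.comp_aemeasurable
      (aemeasurable_secondMoment hT)).aestronglyMeasurable
  have hEm : AEStronglyMeasurable (fun y => ‖E y‖) muI := (Lp.aestronglyMeasurable E).norm
  have hMσ : AEStronglyMeasurable M muI := hMm.aestronglyMeasurable
  set S := eLpNorm γ p muI + eLpNorm q p muI
  calc eLpNorm (T g - g : LpI p) p muI
      ≤ eLpNorm (((10 * N) • fun y => ‖E y‖) + ((2 * σ.toReal) • M) +
        ((12 * N) • fun y => √(secondMoment T y))) p muI := eLpNorm_mono_ae_real hpt
    _ ≤ ENNReal.ofReal (10 * N) * σ + ENNReal.ofReal (2 * σ.toReal) * (ENNReal.ofReal C * S) +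
          ENNReal.ofReal (12 * N) * σ := by
        refine (eLpNorm_add_le ((hEm.const_smul _).add (hMσ.const_smul _)) (hsm.const_smul _)
          hp1.le).trans ?_
        refine add_le_add ((eLpNorm_add_le (hEm.const_smul _) (hMσ.const_smul _) hp1.le).trans
          (add_le_add ?_ ?_)) ?_
        · rw [eLpNorm_const_smul, Real.enorm_eq_ofReal (by positivity), eLpNorm_norm]
          gcongr
        · rw [eLpNorm_const_smul, Real.enorm_eq_ofReal (by positivity)]
          gcongr
          exact (hC q hqm hq).trans (mul_le_mul_right le_add_self _)
        · rw [eLpNorm_const_smul, Real.enorm_eq_ofReal (by positivity)]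
          gcongr
    _ ≤ 10 * S * σ + 2 * σ * (ENNReal.ofReal C * S) + 12 * S * σ := by
        rw [ENNReal.ofReal_mul (by norm_num), ENNReal.ofReal_mul (by norm_num),
          ENNReal.ofReal_mul (by norm_num), ENNReal.ofReal_toReal hσ]
        norm_num only [ENNReal.ofReal_ofNat]
        gcongr
    _ = _ := by
        rw [ENNReal.ofReal_add (by norm_num) (by positivity), ENNReal.ofReal_mul (by norm_num)]
        norm_num only [ENNReal.ofReal_ofNat]
        ring

/-! ### The degenerate case and the final estimate. -/

theorem apply_eq_self {p : ℝ≥0∞} [Fact (1 ≤ p)] (hp : p < ∞) {T : LpI p → LpI p}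
    (hT : IsSublinMonoTrans T) {R : ℝ} (hR : ∀ f, ‖T f‖ ≤ R * ‖f‖) (hR0 : 0 ≤ R)
    (h0 : T (e0 p) = e0 p) (hm : ∀ᵐ y ∂muI, secondMoment T y = 0) (f : LpI p) : T f = f := by
  have hcont : ∀ γ : BoundedContinuousFunction ℝ ℝ, ∀ g : LpI p, g =ᵐ[muI] γ → T g = g := by
    intro γ g hg
    refine Lp.ext ?_
    filter_upwards [ae_quadratic_bounds hT hg, hm, hg, coeFn_e0 p] with y h1 h2 h3 h4
    rw [h2, h0, h4] at h1
    simp only [mul_zero, zero_add, mul_one, add_zero] at h1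
    have h5 : ∀ ε > 0, |T g y - γ y| ≤ ε := by
      intro ε hε
      obtain ⟨η, hη, hηε⟩ := Metric.continuous_iff.1 γ.continuous y ε hε
      -- Korovkin's inequality: continuity controls `t` near `y`, and the quadratic dominates `2
      -- ‖γ‖` elsewhere. As the second moment vanishes, its large coefficient is harmless.
      have h6 : ∀ t, |γ t - γ y| ≤ 2 * ‖γ‖ / η ^ 2 * (t - y) ^ 2 + ε := by
        intro t
        by_cases ht : dist t y < η
        · have h7 : 0 ≤ 2 * ‖γ‖ / η ^ 2 * (t - y) ^ 2 := by positivity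
          have h8 := (hηε t ht).le
          rw [Real.dist_eq] at h8
          linarith
        · have h7 : η ^ 2 ≤ (t - y) ^ 2 := by
            rw [← sq_abs (t - y), ← Real.dist_eq]
            exact pow_le_pow_left₀ hη.le (not_lt.1 ht) 2
          have h8 : |γ t - γ y| ≤ 2 * ‖γ‖ := by
            rw [← Real.dist_eq]
            exact γ.dist_le_two_norm t y
          have h9 : 2 * ‖γ‖ ≤ 2 * ‖γ‖ / η ^ 2 * (t - y) ^ 2 := by
            rw [div_mul_eq_mul_div, le_div_iff₀ (by positivity)]
            gcongr
          linarith
      have hA : 0 ≤ 2 * ‖γ‖ / η ^ 2 := by positivity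
      have h10 := (h1 _ (γ y + ε) hA).1 fun t _ => by linarith [(abs_le.1 (h6 t)).2]
      have h11 := (h1 _ (γ y - ε) hA).2 fun t _ => by linarith [(abs_le.1 (h6 t)).1]
      rw [abs_le]
      constructor <;> linarith
    have h6 : |T g y - γ y| ≤ 0 := le_of_forall_pos_le_add fun ε hε => by simpa using h5 ε hε
    rw [h3]
    exact sub_eq_zero.1 (abs_nonpos_iff.1 h6)
  have hTc : Continuous T := by
    refine (LipschitzWith.of_dist_le_mul (K := ⟨R, hR0⟩) fun f g => ?_).continuous
    rw [dist_eq_norm, dist_eq_norm]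
    exact norm_apply_sub_apply_le hT hR f g
  have hd : DenseRange (BoundedContinuousFunction.toLp (E := ℝ) p muI ℝ) :=
    BoundedContinuousFunction.toLp_denseRange ℝ muI ℝ hp.ne
  have := hd.equalizer hTc continuous_id (funext fun γ => hcont γ _
    (BoundedContinuousFunction.coeFn_toLp p muI ℝ γ))
  exact congrFun this f

theorem mul_half_rpow_sq (x : ℝ≥0∞) : (x ^ (1 / 2 : ℝ)) ^ 2 = x := by
  rw [← ENNReal.rpow_natCast, ← ENNReal.rpow_mul]
  norm_num

/-- The estimate for a smoothing step `s` with `0 < s ≤ 1`. -/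
theorem eLpNorm_apply_sub_le_omega2 {p : ℝ≥0∞} (hp1 : 1 < p) (hp : p < ∞) :
    ∃ C : ℝ, 0 ≤ C ∧ ∀ (T : LpI p → LpI p) (_ : IsSublinMonoTrans T) (R : ℝ), 0 ≤ R →
      (∀ f, ‖T f‖ ≤ R * ‖f‖) → ∀ s : ℝ, 0 < s → s ≤ 1 → sT T = ENNReal.ofReal s → ∀ f : LpI p,
        eLpNorm (T f - f : LpI p) p muI ≤ ENNReal.ofReal (C + 4 * (R + 1)) *
          (sT T ^ 2 * eLpNorm f p muI + omega2 f (sT T)) := by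
  obtain ⟨C, hC0, hC⟩ := eLpNorm_apply_sub_le hp1 hp
  have : Fact (1 ≤ p) := ⟨hp1.le⟩
  refine ⟨C * 148, by positivity, fun T hT R hR0 hR s hs0 hs1 hs f => ?_⟩
  have hsq : sT T ^ 2 = max (max (eLpNorm (T (e0 p) - e0 p : LpI p) p muI)
      (eLpNorm (fun x => √(secondMoment T x)) p muI)) (muT T) := mul_half_rpow_sq _
  have hσ : sT T ^ 2 = ENNReal.ofReal (s ^ 2) := by rw [hs, ENNReal.ofReal_pow hs0.le]
  set W := omega2 f (sT T)
  -- Extension by zero makes primitives available on the whole line; second differences are only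
  -- taken where all three points lie in `[0, 1]`.
  set φ : ℝ → ℝ := (Icc (0 : ℝ) 1).indicator f with hφ
  have hfm : Measurable f := (Lp.stronglyMeasurable f).measurable
  have hφm : Measurable φ := hfm.indicator measurableSet_Icc
  have hfint : IntegrableOn f (Icc (0 : ℝ) 1) := (Lp.memLp f).integrable hp1.le
  have hφint : Integrable φ := (integrable_indicator_iff measurableSet_Icc).2 hfint
  have hφii : ∀ a b, IntervalIntegrable φ volume a b := fun a b => hφint.intervalIntegrable
  have hfφ : f =ᵐ[muI] φ := by
    filter_upwards [ae_restrict_mem measurableSet_Icc] with x hx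
    rw [hφ, indicator_of_mem hx]
  have hW : ∀ h : ℝ, |h| ≤ s → eLpNorm (secDiff h φ) p
      (volume.restrict {x : ℝ | x ∈ Icc (0 : ℝ) 1 ∧ x + 2 * h ∈ Icc (0 : ℝ) 1}) ≤ W := by
    intro h hh
    have h1 : ENNReal.ofReal |h| ≤ sT T := by
      rw [hs]; exact ENNReal.ofReal_le_ofReal hh
    refine le_trans (le_of_eq (eLpNorm_congr_ae ?_)) (le_iSup₂_of_le h h1 le_rfl)
    have hmeas : MeasurableSet {x : ℝ | x ∈ Icc (0 : ℝ) 1 ∧ x + 2 * h ∈ Icc (0 : ℝ) 1} :=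
      measurableSet_Icc.inter
        (measurableSet_Icc.preimage (f := fun x : ℝ => x + 2 * h) (by fun_prop))
    filter_upwards [ae_restrict_mem hmeas] with x hx
    have hx3 : x + h ∈ Icc (0 : ℝ) 1 := by
      constructor <;> linarith [hx.1.1, hx.1.2, hx.2.1, hx.2.2]
    rw [secDiff, hφ, indicator_of_mem hx.1, indicator_of_mem hx.2, indicator_of_mem hx3]
  -- Both steps `δ` and `2δ` stay at most `s`, so the modulus controls them, and below `1 / 2`, so
  -- the contraction factors are positive.
  set δ := s / 8 with hδ
  have hδ0 : 0 < δ := by positivity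
  have hδ8 : δ ≤ 1 / 8 := by linarith
  set γ : ℝ → ℝ := fun x => 2 * steklov δ φ x - steklov (2 * δ) φ x with hγ
  set D : ℝ → ℝ := fun x => 2 * steklovD δ φ x - steklovD (2 * δ) φ x with hD
  set q : ℝ → ℝ := fun x => 2 * steklovDD δ φ x - steklovDD (2 * δ) φ x with hq
  have hqm' : ∀ h, Measurable (steklovDD h φ) := fun h => by
    have := measurable_secDiff hφm h
    unfold steklovDD
    fun_prop
  have hqi' : ∀ h, 1 - 2 * h ≠ 0 → Integrable (steklovDD h φ) := by
    intro h hh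
    have h1 : Integrable (secDiff h φ) :=
      ((hφint.comp_add_right (2 * h)).sub ((hφint.comp_add_right h).const_mul 2)).add hφint
    exact (h1.comp_mul_left' hh).const_mul _
  have hγd : ∀ x, HasDerivAt γ (D x) x := fun x =>
    ((hasDerivAt_steklov hφii δ x).const_mul 2).sub (hasDerivAt_steklov hφii (2 * δ) x)
  have hne1 : 1 - 2 * δ ≠ 0 := by linarith
  have hne2 : 1 - 2 * (2 * δ) ≠ 0 := by linarith
  have hDq : ∀ x y, D y - D x = ∫ u in x..y, q u := by
    intro x y
    rw [hq, intervalIntegral.integral_sub ((hqi' _ hne1).intervalIntegrable.const_mul 2)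
      (hqi' _ hne2).intervalIntegrable, intervalIntegral.integral_const_mul,
      ← steklovD_sub hφii hne1, ← steklovD_sub hφii hne2, hD]
    ring
  have hqm : Measurable q := ((hqm' _).const_mul 2).sub (hqm' _)
  have hqi : Integrable q := ((hqi' _ hne1).const_mul 2).sub (hqi' _ hne2)
  have hγc : Continuous γ := continuous_iff_continuousAt.2 fun x => (hγd x).continuousAt
  have hγL : MemLp γ p muI := by
    obtain ⟨B, hB⟩ := isCompact_Icc.exists_bound_of_continuousOn (hγc.continuousOn (s := Icc 0 1))
    exact (memLp_top_of_bound hγc.aestronglyMeasurable B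
      (by filter_upwards [ae_restrict_mem measurableSet_Icc] with x hx using hB x hx)).mono_exponent
      le_top
  set g : LpI p := hγL.toLp
  have hg : g =ᵐ[muI] γ := hγL.coeFn_toLp
  have hfg : ‖f - g‖ₑ ≤ 4 * W := by
    rw [Lp.enorm_def]
    refine le_trans (le_of_eq (eLpNorm_congr_ae ?_)) (eLpNorm_sub_steklov_le hp1 hp hφm hφii hδ0 hδ8
      fun h hh => hW h (by linarith))
    filter_upwards [Lp.coeFn_sub f g, hfφ, hg] with x h1 h2 h3
    rw [h1, Pi.sub_apply, h2, h3]
  have hγn : eLpNorm γ p muI ≤ eLpNorm f p muI + 4 * W := by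
    rw [← eLpNorm_congr_ae hg, ← Lp.enorm_def, ← Lp.enorm_def]
    calc ‖g‖ₑ = ‖f - (f - g)‖ₑ := by rw [sub_sub_cancel]
      _ ≤ ‖f‖ₑ + ‖f - g‖ₑ := enorm_sub_le
      _ ≤ _ := by gcongr
  -- The 144 is `2 * 64 + 16`, from `2 δ⁻² + (2δ)⁻²` with `δ = s / 8`.
  have hqn : eLpNorm q p muI ≤ ENNReal.ofReal (144 * (s ^ 2)⁻¹) * W := by
    have h1 := eLpNorm_steklovDD_le hp1 hp hδ0 (by linarith)
      (hW δ (by rw [abs_of_pos hδ0]; linarith))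
    have h2 := eLpNorm_steklovDD_le hp1 hp (h := 2 * δ) (by linarith) (by linarith)
      (hW (2 * δ) (by rw [abs_of_pos (by linarith)]; linarith))
    calc eLpNorm q p muI ≤ eLpNorm ((2 : ℝ) • steklovDD δ φ) p muI +
          eLpNorm (steklovDD (2 * δ) φ) p muI :=
          eLpNorm_sub_le ((hqm' _).const_smul (2 : ℝ)).aestronglyMeasurable
            (hqm' _).aestronglyMeasurable hp1.le
      _ ≤ ENNReal.ofReal 2 * (ENNReal.ofReal (δ ^ 2)⁻¹ * W) +
          ENNReal.ofReal ((2 * δ) ^ 2)⁻¹ * W := by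
          rw [eLpNorm_const_smul, Real.enorm_eq_ofReal (by norm_num)]
          gcongr
      _ = _ := by
          rw [← mul_assoc, ← ENNReal.ofReal_mul (by norm_num), ← add_mul,
            ← ENNReal.ofReal_add (by positivity) (by positivity)]
          congr 2
          rw [hδ]
          field_simp
          norm_num
  have hs1' : sT T ^ 2 ≤ 1 := by
    rw [hσ, ← ENNReal.ofReal_one]
    exact ENNReal.ofReal_le_ofReal (by nlinarith)
  have hTg := hC T hT (sT T ^ 2) hs1' (hsq ▸ (le_max_left _ _).trans (le_max_left _ _))
    (hsq ▸ (le_max_right _ _).trans (le_max_left _ _)) (hsq ▸ le_max_right _ _) γ D q hγd hDq hqm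
    hqi g hg
  -- The factor `s²` cancels the `s⁻²` in the bound for `q`, leaving 144; the other 4 comes from `‖f
  -- - g‖`.
  have hsum : sT T ^ 2 * (eLpNorm γ p muI + eLpNorm q p muI) ≤
      148 * (sT T ^ 2 * eLpNorm f p muI + W) := by
    calc _ ≤ sT T ^ 2 * ((eLpNorm f p muI + 4 * W) + ENNReal.ofReal (144 * (s ^ 2)⁻¹) * W) := by
          gcongr
      _ = sT T ^ 2 * eLpNorm f p muI + sT T ^ 2 * (4 * W) +
          (sT T ^ 2 * ENNReal.ofReal (144 * (s ^ 2)⁻¹)) * W := by ring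
      _ = sT T ^ 2 * eLpNorm f p muI + sT T ^ 2 * (4 * W) + 144 * W := by
          congr 2
          rw [hσ, ← ENNReal.ofReal_mul (by positivity),
            show s ^ 2 * (144 * (s ^ 2)⁻¹) = 144 by field_simp, ENNReal.ofReal_ofNat]
      _ ≤ 148 * (sT T ^ 2 * eLpNorm f p muI) + 1 * (4 * W) + 144 * W := by
          refine add_le_add_left (add_le_add ?_ (mul_le_mul_left hs1' _)) _
          exact le_mul_of_one_le_left zero_le (by norm_num)
      _ = _ := by ring
  have hTfg : ‖T f - T g‖ₑ ≤ ENNReal.ofReal R * ‖f - g‖ₑ := by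
    rw [← ofReal_norm, ← ofReal_norm, ← ENNReal.ofReal_mul hR0]
    exact ENNReal.ofReal_le_ofReal (norm_apply_sub_apply_le hT hR f g)
  rw [← Lp.enorm_def] at hTg ⊢
  calc ‖T f - f‖ₑ = ‖(T f - T g) + (T g - g) - (f - g)‖ₑ := by congr 1; abel
    _ ≤ ‖T f - T g‖ₑ + ‖T g - g‖ₑ + ‖f - g‖ₑ :=
        enorm_sub_le.trans (add_le_add_left (enorm_add_le _ _) _)
    _ ≤ ENNReal.ofReal R * (4 * W) +
          ENNReal.ofReal C * (148 * (sT T ^ 2 * eLpNorm f p muI + W)) + 4 * W := by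
        gcongr
        · exact hTfg.trans (by gcongr)
        · exact hTg.trans (by gcongr)
    _ = ENNReal.ofReal (C * 148) * (sT T ^ 2 * eLpNorm f p muI + W) +
          ENNReal.ofReal (4 * (R + 1)) * W := by
        rw [ENNReal.ofReal_mul hC0, ENNReal.ofReal_mul (by norm_num),
          ENNReal.ofReal_add hR0 zero_le_one, ENNReal.ofReal_one]
        norm_num only [ENNReal.ofReal_ofNat]
        ring
    _ ≤ _ := by
        rw [ENNReal.ofReal_add (by positivity) (by positivity), add_mul]
        gcongr
        exact le_add_self

end SublinearApprox

end

theorem mainTheorem4 (p : ℝ≥0∞) (hp1 : 1 < p) (hp2 : p < ∞)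
    (T : ℕ → SublinearApprox.LpI p → SublinearApprox.LpI p)
    (hT : ∀ n, SublinearApprox.IsSublinMonoTrans (T n))
    (hbdd : ∃ R : ℝ, ∀ (n : ℕ) (f : SublinearApprox.LpI p), ‖T n f‖ ≤ R * ‖f‖)
    (hs : Tendsto (fun n => SublinearApprox.sT (T n)) atTop (𝓝 0)) :
    ∃ M : ℝ, 0 < M ∧ ∀ (n : ℕ) (f : SublinearApprox.LpI p),
      eLpNorm (T n f - f : SublinearApprox.LpI p) p SublinearApprox.muI ≤
        ENNReal.ofReal M *
          (SublinearApprox.sT (T n) ^ 2 * eLpNorm f p SublinearApprox.muI +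
            SublinearApprox.omega2 f (SublinearApprox.sT (T n))) := by
  open SublinearApprox in
  have : Fact (1 ≤ p) := ⟨hp1.le⟩
  obtain ⟨R', hR'⟩ := hbdd
  obtain ⟨C, hC0, hC⟩ := eLpNorm_apply_sub_le_omega2 hp1 hp2
  set R := max R' 0
  have hR0 : 0 ≤ R := le_max_right _ _
  have hR : ∀ n f, ‖T n f‖ ≤ R * ‖f‖ := fun n f =>
    (hR' n f).trans (mul_le_mul_of_nonneg_right (le_max_left _ _) (norm_nonneg _))
  refine ⟨C + 4 * (R + 1), by positivity, fun n f => ?_⟩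
  rcases eq_or_ne (sT (T n)) 0 with h0 | h0
  · have hsq : sT (T n) ^ 2 = _ := mul_half_rpow_sq _
    rw [h0, zero_pow two_ne_zero, eq_comm, ← bot_eq_zero, max_eq_bot, max_eq_bot] at hsq
    simp only [bot_eq_zero] at hsq
    obtain ⟨⟨h1, -⟩, h3⟩ := hsq
    have h4 : T n (e0 p) = e0 p := by
      rw [← Lp.enorm_def, enorm_eq_zero] at h1
      exact sub_eq_zero.1 h1
    have h5 : ∀ᵐ y ∂muI, secondMoment (T n) y = 0 := by
      rw [muT, eLpNorm_eq_zero_iff (aemeasurable_secondMoment (hT n)).aestronglyMeasurable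
        ENNReal.top_ne_zero] at h3
      exact h3
    have h6 : T n f - f = 0 := sub_eq_zero.2 (apply_eq_self hp2 (hT n) (hR n) hR0 h4 h5 f)
    rw [← Lp.enorm_def, h6, enorm_zero]
    exact zero_le
  rcases le_or_gt 1 (sT (T n)) with h1 | h1
  -- Here `s² ≥ 1`, so the term `s² ‖f‖` alone dominates, also when `s = ∞`.
  · calc eLpNorm (T n f - f : LpI p) p muI = ‖T n f - f‖ₑ := (Lp.enorm_def _).symm
      _ ≤ ‖T n f‖ₑ + ‖f‖ₑ := enorm_sub_le
      _ ≤ ENNReal.ofReal R * ‖f‖ₑ + ‖f‖ₑ := by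
          gcongr
          rw [← ofReal_norm, ← ofReal_norm, ← ENNReal.ofReal_mul hR0]
          exact ENNReal.ofReal_le_ofReal (hR n f)
      _ = ENNReal.ofReal (R + 1) * ‖f‖ₑ := by
          rw [ENNReal.ofReal_add hR0 zero_le_one, ENNReal.ofReal_one, add_mul, one_mul]
      _ ≤ ENNReal.ofReal (C + 4 * (R + 1)) * (sT (T n) ^ 2 * eLpNorm f p muI) := by
          rw [← Lp.enorm_def]
          exact mul_le_mul' (ENNReal.ofReal_le_ofReal (by linarith))
            (le_mul_of_one_le_left zero_le (one_le_pow₀ h1))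
      _ ≤ _ := by
          gcongr
          exact le_self_add
  · have hfin : sT (T n) ≠ ∞ := (h1.trans ENNReal.one_lt_top).ne
    exact hC (T n) (hT n) R hR0 (hR n) (sT (T n)).toReal (ENNReal.toReal_pos h0 hfin)
      (by simpa using ENNReal.toReal_mono ENNReal.one_ne_top h1.le)
      (ENNReal.ofReal_toReal hfin).symm f
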